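/- Consider a finite directed network (parallel links allowed) in discrete time. Each packet is injected at some time at a source node with a prescribed destination node, finitely many packets at each time, and it has to follow a route, i.e. a (simple) directed path from its source to its destination. In each time step each link whose queue is nonempty processes exactly one packet of its queue. Under First-In-First-Out (FIFO) this is a packet that arrived at the link earliest; under Nearest-To-Go (NTG) it is a packet with the smallest number of hops remaining to its destination; ties are broken arbitrarily. An injection sequence (which specifies times, sources and destinations, but no routes) is $(w,r)$-admissible if routes for all its packets exist such that for every link $e$ and every time interval of length $T\ge w$, at most $Tr$ of the packets injected in this interval have a route through $e$. A protocol is unstable under an injection sequence regardless of how packets are routed if, for every choice of a route for each packet and for every way of breaking ties, the number of packets in the network (injected and not yet delivered) is unbounded over time. Theorem. There exists a network $G$ such that: (a) for every rate $r$ with $0.9\le r<1$ there are a window size $w\ge 1$ and a $(w,r)$-admissible injection sequence on $G$ under which FIFO is unstable regardless of how packets are routed; (b) for every rate $r$ with $1/\sqrt2<r<1$ there are a window size $w\ge 1$ and a $(w,r)$-admissible injection sequence on $G$ under which NTG is unstable regardless of how packets are routed. -/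

import Mathlib

/-- A finite directed network. Parallel links are allowed. -/
structure Network where
  /-- the nodes -/
  Node : Type
  /-- the links -/
  Link : Type
  finite_node : Finite Node
  finite_link : Finite Link
  /-- the node at which a link starts -/
  tail : Link → Node
  /-- the node at which a link ends -/
  head : Link → Node

namespace Network

/-- The list of links `l` leads from node `u` to node `v`. -/
def IsWalk (G : Network) : G.Node → G.Node → List G.Link → Prop
  | u, v, [] => u = v
  | u, v, e :: l => G.tail e = u ∧ G.IsWalk (G.head e) v l

/-- The list of links `l` is a (simple) path from `u` to `v`: no node is visited twice. -/
def IsPath (G : Network) (u v : G.Node) (l : List G.Link) : Prop :=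
  G.IsWalk u v l ∧ (u :: l.map G.head).Nodup

/-- A sequence of packet injections: every packet has an injection time, a source and
a destination, and finitely many packets are injected at each time. The injections do not
specify routes. -/
structure Injections (G : Network) where
  /-- the packets -/
  Packet : Type
  /-- the injection time -/
  time : Packet → ℕ
  /-- the source node -/
  source : Packet → G.Node
  /-- the destination node -/
  dest : Packet → G.Node
  finite_time : ∀ t, {p | time p = t}.Finite

namespace Injections

variable {G : Network} (σ : G.Injections)

/-- `ρ` assigns to each packet a route, i.e. a path from its source to its destination. -/
def IsRouting (ρ : σ.Packet → List G.Link) : Prop :=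
  ∀ p, G.IsPath (σ.source p) (σ.dest p) (ρ p)

/-- The routes `ρ` are `(w, r)`-admissible: for every link `e` and every time interval of
length `T ≥ w`, at most `T r` packets injected in the interval have a route through `e`. -/
def AdmissibleRoutes (w : ℕ) (r : ℝ) (ρ : σ.Packet → List G.Link) : Prop :=
  ∀ (e : G.Link) (t T : ℕ), w ≤ T →
    (({p | t ≤ σ.time p ∧ σ.time p < t + T ∧ e ∈ ρ p} : Set σ.Packet).ncard : ℝ) ≤ T * r

/-- The injections are `(w, r)`-admissible: the packets have `(w, r)`-admissible routes. -/
def Admissible (w : ℕ) (r : ℝ) : Prop :=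
  ∃ ρ : σ.Packet → List G.Link, σ.IsRouting ρ ∧ σ.AdmissibleRoutes w r ρ

/-! In a run of the network, `sent t e` is the packet, if any, that link `e` processes in
time step `t` (between time `t` and time `t + 1`). -/

open Classical in
/-- The number of links that packet `p` has crossed by time `t`. -/
noncomputable def hops (sent : ℕ → G.Link → Option σ.Packet) : ℕ → σ.Packet → ℕ
  | 0, _ => 0
  | t + 1, p => hops sent t p + if ∃ e, sent t e = some p then 1 else 0

open Classical in
/-- The time at which packet `p` arrived at the link where it is at time `t`: the time of its
injection, or else the time at which it finished crossing its previous link. -/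
noncomputable def arrival (sent : ℕ → G.Link → Option σ.Packet) : ℕ → σ.Packet → ℕ
  | 0, p => σ.time p
  | t + 1, p => if ∃ e, sent t e = some p then t + 1 else arrival sent t p

/-- The packets that wait at time `t` to cross link `e`: those already injected whose
next link is `e`. -/
def queue (ρ : σ.Packet → List G.Link) (sent : ℕ → G.Link → Option σ.Packet)
    (t : ℕ) (e : G.Link) : Set σ.Packet :=
  {p | σ.time p ≤ t ∧ (ρ p)[σ.hops sent t p]? = some e}

/-- The number of packets in the network at time `t`: injected and not yet delivered. -/
noncomputable def numPackets (ρ : σ.Packet → List G.Link)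
    (sent : ℕ → G.Link → Option σ.Packet) (t : ℕ) : ℕ :=
  {p | σ.time p ≤ t ∧ σ.hops sent t p < (ρ p).length}.ncard

end Injections

/-- The two scheduling protocols: First-In-First-Out and Nearest-To-Go. -/
inductive Protocol
  | fifo
  | ntg

namespace Injections

variable {G : Network} (σ : G.Injections)

/-- The quantity that a protocol minimizes when it selects a packet: the time of arrival at the
link (FIFO), or the number of hops remaining to the destination (NTG). -/
noncomputable def rank (π : Protocol) (ρ : σ.Packet → List G.Link)
    (sent : ℕ → G.Link → Option σ.Packet) (t : ℕ) (p : σ.Packet) : ℕ :=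
  match π with
  | .fifo => σ.arrival sent t p
  | .ntg => (ρ p).length - σ.hops sent t p

/-- `sent` is a run under protocol `π` of the injections `σ` with routes `ρ`: in each step each
link with a nonempty queue processes one packet of its queue, of minimal rank in this queue
(ties may be broken in any way), and a link with an empty queue processes none. -/
def IsRun (π : Protocol) (ρ : σ.Packet → List G.Link)
    (sent : ℕ → G.Link → Option σ.Packet) : Prop :=
  ∀ (t : ℕ) (e : G.Link),
    (sent t e = none → σ.queue ρ sent t e = ∅) ∧
    ∀ p, sent t e = some p → p ∈ σ.queue ρ sent t e ∧
      ∀ q ∈ σ.queue ρ sent t e, σ.rank π ρ sent t p ≤ σ.rank π ρ sent t q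

end Injections

/-- Protocol `π` is unstable on `G` under the injections `σ` regardless of how the packets are
routed: for every choice of routes, in every run the number of packets in the network is
unbounded. -/
def UnstableForAllRoutes (G : Network) (π : Protocol) (σ : G.Injections) : Prop :=
  ∀ ρ : σ.Packet → List G.Link, σ.IsRouting ρ →
    ∀ sent : ℕ → G.Link → Option σ.Packet, σ.IsRun π ρ sent →
      ∀ B : ℕ, ∃ t : ℕ, B < σ.numPackets ρ sent t

end Network

/-! Each kind of packet has a source and a destination joined by exactly one simple path, so there
is no freedom in routing, and it suffices to destabilize the protocol with fixed routes. The network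
is two copies of one gadget, and time is cut into phases. At the start of a phase about `s` packets
still have to cross the link `e` of one half, followed by `l` and `g`; the phase converts them into
a larger backlog of the same form at the other half, and the halves swap roles.

Let ρ be the injection rate. Under nearest-to-go, ρs packets `W` and ρs packets `X` are injected
while the old packets cross `e`; both have more hops to go, so `W` waits at `e` and `X` at `g`. In
the next ρs steps the packets `W` stream through `y` and hold back ρ²s new packets `Y` there, while
packets `Zx` occupy `x`, so that `X` gets through only at rate 1 - ρ. The new backlog is ρs + ρ²s -
(1 - ρ)ρs = 2ρ²s, which exceeds s exactly when ρ > 1/√2.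

Under first-in-first-out a blocker has to arrive before what it blocks. Packets `Zg` lengthen the
queue at `g` before `X` is injected, packets `Zy` lengthen that at `y` before `Y` is, and the
periods of a phase last about s, ρs, ρ²s, ρ³s. Mixed with `Zx`, the packets `X` leave `x` at rate
1/(1 + ρ); in the last period `V` is injected directly in front of the other half. Up to ρ³s(1/(1 +
ρ) + ρ) packets can be left, which is more than s at ρ = 17/19 < 0.9.

In both constructions the surplus is given up (fewer `Y`, respectively fewer `V`), so that the
backlog grows linearly in the phase number, with a bounded error. The argument uses cumulative
counts only: `isFlow_of_isRun` turns a run into an `IsFlow`, each link becomes a `Single`, `Prio` or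
`Fifo` server, and `ntg_phase` and `fifo_phase` propagate the invariants `NtgInv` and `FifoInv`.
Admissibility is `IsSchedule.admissible`: in each slot at most one new packet uses a given link,
apart from an initial burst that a large window absorbs. -/

/-! ### The network and the kinds of packets -/

/-- The nodes of one half of the network. -/
inductive Vertex | a | b | v | c | k | u | d
  deriving DecidableEq

instance : Fintype Vertex :=
  ⟨{.a, .b, .v, .c, .k, .u, .d}, by intro z; cases z <;> decide⟩

/-- The links that start in one half of the network. -/
inductive Arc | e | l | g | x | k | j | y | m
  deriving DecidableEq

instance : Fintype Arc :=
  ⟨{.e, .l, .g, .x, .k, .j, .y, .m}, by intro z; cases z <;> decide⟩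

/-- Two copies of a network that forks at `b`, with the branches `b → v → c` and
`b → k → u → d`; both branches lead on to the node `a` of the other copy. -/
abbrev forkNet : Network where
  Node := Bool × Vertex
  Link := Bool × Arc
  finite_node := inferInstance
  finite_link := inferInstance
  tail := fun f => (f.1, match f.2 with
    | .e => .a | .l => .b | .g => .v | .x => .c | .k => .b | .j => .k | .y => .u | .m => .d)
  head := fun f => match f.2 with
    | .e => (f.1, .b) | .l => (f.1, .v) | .g => (f.1, .c) | .x => (!f.1, .a)
    | .k => (f.1, .k) | .j => (f.1, .u) | .y => (f.1, .d) | .m => (!f.1, .a)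

/-- The sorts of packets that are injected into one half of the network. -/
inductive Load | W | X | Y | V | Zx | Zg | Zy
  deriving DecidableEq

instance : Fintype Load :=
  ⟨{.W, .X, .Y, .V, .Zx, .Zg, .Zy}, by intro z; cases z <;> decide⟩

abbrev Kind := Bool × Load

/-- The route of a packet of a given kind. -/
def route : Kind → List (Bool × Arc)
  | (h, .W) => [(h, .e), (h, .k), (h, .j), (h, .y)]
  | (h, .X) => [(h, .g), (h, .x), (!h, .e), (!h, .l), (!h, .g)]
  | (h, .Y) => [(h, .y), (h, .m), (!h, .e), (!h, .l), (!h, .g)]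
  | (h, .V) => [(!h, .e), (!h, .l), (!h, .g)]
  | (h, .Zx) => [(h, .x)]
  | (h, .Zg) => [(h, .g)]
  | (h, .Zy) => [(h, .y)]

def src : Kind → Bool × Vertex
  | (h, .W) => (h, .a)
  | (h, .X) => (h, .v)
  | (h, .Y) => (h, .u)
  | (h, .V) => (!h, .a)
  | (h, .Zx) => (h, .c)
  | (h, .Zg) => (h, .v)
  | (h, .Zy) => (h, .u)

def dst : Kind → Bool × Vertex
  | (h, .W) => (h, .d)
  | (h, .X) => (!h, .c)
  | (h, .Y) => (!h, .c)
  | (h, .V) => (!h, .c)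
  | (h, .Zx) => (!h, .a)
  | (h, .Zg) => (h, .c)
  | (h, .Zy) => (h, .d)

/-! ### Uniqueness of the routes -/

def arcs : List (Bool × Arc) :=
  [false, true].flatMap fun h => [.e, .l, .g, .x, .k, .j, .y, .m].map fun f => (h, f)

theorem mem_arcs (f : Bool × Arc) : f ∈ arcs := by
  revert f; decide

/-- All paths with fewer than `n` links from `u` to `w` that avoid the nodes of `vis`. -/
def pathsFrom (w : Bool × Vertex) :
    ℕ → List (Bool × Vertex) → Bool × Vertex → List (List (Bool × Arc))
  | 0, _, _ => []
  | n + 1, vis, u =>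
    if u = w then [[]] else
      (arcs.filter fun f => forkNet.tail f = u ∧ forkNet.head f ∉ vis).flatMap fun f =>
        (pathsFrom w n (forkNet.head f :: vis) (forkNet.head f)).map (f :: ·)

theorem Network.IsWalk.target_mem {G : Network} {v : G.Node} {l : List G.Link} :
    ∀ {u}, G.IsWalk u v l → l ≠ [] → v ∈ l.map G.head := by
  induction l with
  | nil => intro u _ h; exact absurd rfl h
  | cons f l ih =>
    rintro u ⟨_, h⟩ _
    rcases l with _ | ⟨f', l⟩
    · have : G.head f = v := h
      simp [this]
    · have := ih h (by simp)
      rw [List.map_cons]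
      exact List.mem_cons_of_mem _ this

/-- The search stops at `w` and never enters a node of `vis`. This loses nothing, since a simple
path meets its target only at its end and does not return to a node. -/
theorem mem_pathsFrom {w : Bool × Vertex} {l : List (Bool × Arc)} :
    ∀ {n : ℕ} {vis : List (Bool × Vertex)} {u : Bool × Vertex}, forkNet.IsWalk u w l →
      (u :: l.map forkNet.head).Nodup → (∀ x ∈ l.map forkNet.head, x ∉ vis) →
      l.length < n → l ∈ pathsFrom w n vis u := by
  induction l with
  | nil =>
    intro n vis u h _ _ hn
    obtain ⟨n, rfl⟩ : ∃ k, n = k + 1 := ⟨n - 1, by simp at hn; omega⟩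
    have : u = w := h
    simp [pathsFrom, this]
  | cons f l ih =>
    intro n vis u h hd hv hn
    obtain ⟨n, rfl⟩ : ∃ k, n = k + 1 := ⟨n - 1, by simp at hn; omega⟩
    have hne : u ≠ w := by
      rintro rfl
      exact (List.nodup_cons.1 hd).1 (h.target_mem (by simp))
    rw [pathsFrom, if_neg hne, List.mem_flatMap]
    refine ⟨f, ?_, ?_⟩
    · rw [List.mem_filter]
      refine ⟨mem_arcs f, ?_⟩
      have h1 := hv (forkNet.head f) (by simp)
      simpa using And.intro h.1 h1
    · refine List.mem_map.2 ⟨l, ih h.2 (List.nodup_cons.1 hd).2 ?_ (by simp at hn; omega), rfl⟩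
      intro x hx
      rw [List.mem_cons, not_or]
      refine ⟨?_, hv x (List.mem_cons_of_mem _ hx)⟩
      rintro rfl
      exact (List.nodup_cons.1 (List.nodup_cons.1 hd).2).1 hx

-- This exhaustive search is what makes routing irrelevant. Paths with fewer than 14 links suffice
-- because the network has 14 nodes.
set_option maxRecDepth 10000 in
theorem pathsFrom_src (K : Kind) : pathsFrom (dst K) 14 [src K] (src K) = [route K] := by
  revert K; decide

theorem isPath_iff_route (K : Kind) (l : List (Bool × Arc)) :
    forkNet.IsPath (src K) (dst K) l ↔ l = route K := by
  constructor
  · rintro ⟨hw, hd⟩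
    have hl : l.length < 14 := by
      have := hd.length_le_card
      simp only [List.length_cons, List.length_map] at this
      have hc : Fintype.card (Bool × Vertex) = 14 := by decide
      omega
    have := mem_pathsFrom (n := 14) (vis := [src K]) hw hd (by
      intro x hx
      rw [List.mem_singleton]
      rintro rfl
      exact (List.nodup_cons.1 hd).1 hx) hl
    rw [pathsFrom_src] at this
    simpa using this
  · rintro rfl
    rcases K with ⟨h, K⟩
    cases h <;> cases K <;>
      exact ⟨by simp [src, dst, route, Network.IsWalk], by simp [src, route]⟩

/-! ### Injections with prescribed counts -/

/-- The injections with `num t K` packets of kind `K` at time `t`. -/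
abbrev injections (num : ℕ → Kind → ℕ) : forkNet.Injections where
  Packet := Σ x : ℕ × Kind, Fin (num x.1 x.2)
  time := fun p => p.1.1
  source := fun p => src p.1.2
  dest := fun p => dst p.1.2
  finite_time := by
    intro t
    have : {p : Σ x : ℕ × Kind, Fin (num x.1 x.2) | p.1.1 = t} ⊆
        Set.range fun y : (Σ K : Kind, Fin (num t K)) =>
          (⟨(t, y.1), y.2⟩ : Σ x : ℕ × Kind, Fin (num x.1 x.2)) := by
      rintro ⟨⟨t', K⟩, i⟩ rfl
      exact ⟨⟨K, i⟩, rfl⟩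
    exact (Set.finite_range _).subset this

theorem isRouting_iff {num : ℕ → Kind → ℕ} {ρ : (injections num).Packet → List forkNet.Link} :
    (injections num).IsRouting ρ ↔ ρ = fun p => route p.1.2 := by
  constructor
  · intro h
    funext p
    exact (isPath_iff_route p.1.2 _).1 (h p)
  · rintro rfl p
    exact (isPath_iff_route p.1.2 _).2 rfl

theorem setOf_time_mem_eq {num : ℕ → Kind → ℕ} (s : Finset (ℕ × Kind)) :
    ({p : (injections num).Packet | p.1 ∈ s}).ncard = ∑ x ∈ s, num x.1 x.2 := by
  have : {p : (injections num).Packet | p.1 ∈ s} =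
      ((s.sigma fun x => (Finset.univ : Finset (Fin (num x.1 x.2)))) :
        Set (Σ x : ℕ × Kind, Fin (num x.1 x.2))) := by
    ext p; simp
  rw [this, Set.ncard_coe_finset, Finset.card_sigma]
  simp

theorem finite_setOf_mem {num : ℕ → Kind → ℕ} (s : Finset (ℕ × Kind)) :
    ({p : (injections num).Packet | p.1 ∈ s}).Finite := by
  have : {p : (injections num).Packet | p.1 ∈ s} =
      ((s.sigma fun x => (Finset.univ : Finset (Fin (num x.1 x.2)))) :
        Set (Σ x : ℕ × Kind, Fin (num x.1 x.2))) := by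
    ext p; simp
  rw [this]
  exact Finset.finite_toSet _

/-! ### Slots at rate p / q, and admissibility -/

/-- The number of `t ∈ [u, v)` at which packets are injected, at rate `p / q`. -/
def slots (p q u v : ℕ) : ℕ := ∑ t ∈ Finset.Ico u v, if t % q < p then 1 else 0

theorem slots_add {p q u v w : ℕ} (h : u ≤ v) (h' : v ≤ w) :
    slots p q u v + slots p q v w = slots p q u w :=
  Finset.sum_Ico_consecutive _ h h'

theorem slots_succ {p q u v : ℕ} (h : u ≤ v) :
    slots p q u (v + 1) = slots p q u v + if v % q < p then 1 else 0 :=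
  Finset.sum_Ico_succ_top h _

theorem slots_self {p q u : ℕ} : slots p q u u = 0 := by simp [slots]

theorem slots_period {p q : ℕ} (hp : p ≤ q) (u : ℕ) : slots p q u (u + q) = p := by
  have h := Nat.filter_Ico_card_eq_of_periodic u q (fun t => t % q < p) (by
    intro t; simp)
  rw [slots, ← Finset.card_filter, h, Nat.count_eq_card_filter_range]
  have : (Finset.range q).filter (fun t => t % q < p) = Finset.range p := by
    ext t
    simp only [Finset.mem_filter, Finset.mem_range]
    constructor
    · rintro ⟨h1, h2⟩
      rwa [Nat.mod_eq_of_lt h1] at h2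
    · intro h1
      have : t < q := by omega
      exact ⟨this, by rwa [Nat.mod_eq_of_lt this]⟩
  rw [this, Finset.card_range]

theorem slots_mul {p q : ℕ} (hp : p ≤ q) (u j : ℕ) : slots p q u (u + q * j) = p * j := by
  induction j with
  | zero => simp [slots]
  | succ j ih =>
    rw [← slots_add (v := u + q * j) (by omega) (by rw [Nat.mul_succ]; omega), ih,
      Nat.mul_succ, ← add_assoc, slots_period hp, Nat.mul_succ]

theorem slots_mono {p q u v u' v' : ℕ} (h : u' ≤ u) (h' : v ≤ v') :
    slots p q u v ≤ slots p q u' v' :=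
  Finset.sum_le_sum_of_subset (Finset.Ico_subset_Ico h h')

/-- Enclosing the interval between two whole numbers of periods gives the rate p / q up to an error
of one period. The denominators are cleared so that later estimates remain in ℕ. -/
theorem slots_bounds {p q : ℕ} (hp : p ≤ q) (hq : 0 < q) (u T : ℕ) :
    q * slots p q u (u + T) ≤ p * T + p * q ∧ p * T ≤ q * slots p q u (u + T) + p * q := by
  have h1 := slots_mul hp u (T / q)
  have h2 := slots_mul hp u (T / q + 1)
  have h3 := Nat.div_add_mod T q
  have h4 := Nat.mod_lt T hq
  have h5 : slots p q u (u + q * (T / q)) ≤ slots p q u (u + T) := slots_mono le_rfl (by omega)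
  have h6 : slots p q u (u + T) ≤ slots p q u (u + q * (T / q + 1)) :=
    slots_mono le_rfl (by rw [Nat.mul_succ]; omega)
  rw [h1] at h5
  rw [h2] at h6
  constructor
  · calc q * slots p q u (u + T) ≤ q * (p * (T / q + 1)) := Nat.mul_le_mul_left _ h6
      _ = p * (q * (T / q)) + p * q := by ring
      _ ≤ p * T + p * q := by gcongr; omega
  · calc p * T ≤ p * (q * (T / q) + q) := by gcongr; omega
      _ = q * (p * (T / q)) + p * q := by ring
      _ ≤ _ := by gcongr

theorem admissible_of_slots {num : ℕ → Kind → ℕ} {p q s : ℕ} {r : ℝ} (hp : p ≤ q) (hq : 0 < q)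
    (hr : (p : ℝ) / q < r)
    (h : ∀ t f, ∑ K with f ∈ route K, num t K ≤
      (if t % q < p then 1 else 0) + if t = 0 then s else 0) :
    ∃ w : ℕ, 0 < w ∧ (injections num).Admissible w r := by
  -- Once the window has this length, the slack `r - p / q` pays for the rounding error `p` of the
  -- slots and for the burst `s`.
  obtain ⟨w, hw⟩ := exists_nat_gt ((p + s : ℝ) / (r - p / q))
  refine ⟨w + 1, by omega, fun p => route p.1.2, isRouting_iff.2 rfl, ?_⟩
  intro f t T hT
  have hset : {x : (injections num).Packet | t ≤ (injections num).time x ∧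
      (injections num).time x < t + T ∧ f ∈ route x.1.2} =
      {x | x.1 ∈ Finset.Ico t (t + T) ×ˢ Finset.univ.filter fun K => f ∈ route K} := by
    ext x; simp [and_assoc]
  rw [hset, setOf_time_mem_eq, Finset.sum_product]
  have h1 : ∑ x ∈ Finset.Ico t (t + T), ∑ y with f ∈ route y, num x y ≤
      slots p q t (t + T) + s := by
    refine (Finset.sum_le_sum fun x _ => h x f).trans ?_
    rw [Finset.sum_add_distrib]
    refine Nat.add_le_add le_rfl ?_
    rw [Finset.sum_ite_eq']
    split_ifs <;> simp
  have h2 := (slots_bounds hp hq t T).1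
  have hq' : (0 : ℝ) < q := by exact_mod_cast hq
  have h3 : (slots p q t (t + T) : ℝ) ≤ T * (p / q) + p := by
    have : (q : ℝ) * slots p q t (t + T) ≤ p * T + p * q := by exact_mod_cast h2
    have h4 : (q : ℝ) * (T * (p / q) + p) = p * T + p * q := by field_simp
    nlinarith
  have h5 : (p + s : ℝ) ≤ T * (r - p / q) := by
    rw [div_lt_iff₀ (by linarith)] at hw
    have : (w : ℝ) ≤ T := by exact_mod_cast (by omega : w ≤ T)
    nlinarith
  have h6 : ((∑ x ∈ Finset.Ico t (t + T), ∑ y with f ∈ route y, num x y : ℕ) : ℝ) ≤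
      slots p q t (t + T) + s := by exact_mod_cast h1
  refine h6.trans ?_
  nlinarith

/-! ### Runs as cumulative counts -/

/-- The counts of packets in a run: `ar K i t` packets of kind `K` have reached link number `i`
of their route by time `t`, and `cr K i t` of them have crossed it. -/
structure IsFlow (num : ℕ → Kind → ℕ) (π : Network.Protocol) (ar cr : Kind → ℕ → ℕ → ℕ) : Prop where
  ar_zero : ∀ K t, ar K 0 t = ∑ u ∈ Finset.range (t + 1), num u K
  ar_succ : ∀ K i t, ar K (i + 1) t = cr K i t
  cr_zero : ∀ K i, cr K i 0 = 0
  cr_le : ∀ K i t, i < (route K).length → cr K i t ≤ ar K i t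
  step : ∀ t f,
    (∀ K i, (route K)[i]? = some f → cr K i (t + 1) = cr K i t ∧ ar K i t = cr K i t) ∨
    ∃ K i, (route K)[i]? = some f ∧ cr K i t < ar K i t ∧ cr K i (t + 1) = cr K i t + 1 ∧
      ∀ K' i', (route K')[i']? = some f →
        ((K', i') ≠ (K, i) → cr K' i' (t + 1) = cr K' i' t) ∧
        (π = .ntg → (route K').length - i' < (route K).length - i → ar K' i' t = cr K' i' t)
  fifo : π = .fifo → ∀ f K i K' i' τ t, (route K)[i]? = some f → (route K')[i']? = some f →
    ar K i τ < cr K i t → ar K' i' τ ≤ cr K' i' t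

section Run

variable {num : ℕ → Kind → ℕ} {sent : ℕ → forkNet.Link → Option (injections num).Packet}

/-- The packets of kind `K` that have crossed link number `i` of their route by time `t`. -/
def crossed (sent : ℕ → forkNet.Link → Option (injections num).Packet) (K : Kind) (i t : ℕ) :
    Set (injections num).Packet :=
  {p | p.1.2 = K ∧ i < (injections num).hops sent t p}

/-- The packets of kind `K` that have reached link number `i` of their route by time `t`. -/
def arrived (sent : ℕ → forkNet.Link → Option (injections num).Packet) (K : Kind) (i t : ℕ) :
    Set (injections num).Packet :=
  {p | p.1.2 = K ∧ p.1.1 ≤ t ∧ i ≤ (injections num).hops sent t p}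

theorem finite_setOf_time_le (t : ℕ) : {p : (injections num).Packet | p.1.1 ≤ t}.Finite := by
  refine (finite_setOf_mem (num := num) (Finset.range (t + 1) ×ˢ Finset.univ)).subset ?_
  intro p hp
  have : p.1.1 ≤ t := hp
  simp
  omega

theorem hops_succ_of_sent {t : ℕ} {p : (injections num).Packet} {f : forkNet.Link}
    (h : sent t f = some p) :
    (injections num).hops sent (t + 1) p = (injections num).hops sent t p + 1 := by
  rw [Network.Injections.hops, if_pos ⟨f, h⟩]

theorem hops_succ_of_not_sent {t : ℕ} {p : (injections num).Packet}
    (h : ¬ ∃ f, sent t f = some p) :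
    (injections num).hops sent (t + 1) p = (injections num).hops sent t p := by
  rw [Network.Injections.hops, if_neg h, add_zero]

theorem hops_mono {p : (injections num).Packet} :
    Monotone fun t => (injections num).hops sent t p :=
  monotone_nat_of_le_succ fun t => by
    simp only [Network.Injections.hops]; omega

theorem arrival_le {t : ℕ} {p : (injections num).Packet} :
    (injections num).arrival sent t p ≤ max t p.1.1 := by
  induction t with
  | zero => simp [Network.Injections.arrival]
  | succ t ih =>
    rw [Network.Injections.arrival]
    split_ifs <;> omega

theorem arrival_eq_of_hops_eq {s t : ℕ} (hst : s ≤ t) {p : (injections num).Packet}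
    (h : (injections num).hops sent t p = (injections num).hops sent s p) :
    (injections num).arrival sent t p = (injections num).arrival sent s p := by
  induction t, hst using Nat.le_induction with
  | base => rfl
  | succ t hst ih =>
    by_cases hs : ∃ f, sent t f = some p
    · obtain ⟨f, hf⟩ := hs
      have h1 := hops_succ_of_sent hf
      have h2 : (injections num).hops sent s p ≤ (injections num).hops sent t p := hops_mono hst
      omega
    · rw [hops_succ_of_not_sent hs] at h
      rw [Network.Injections.arrival, if_neg hs, ih h]

theorem hops_eq_of_arrival_le {s t : ℕ} (hst : s ≤ t) {p : (injections num).Packet}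
    (h : (injections num).arrival sent t p ≤ s) :
    (injections num).hops sent t p = (injections num).hops sent s p := by
  induction t, hst using Nat.le_induction with
  | base => rfl
  | succ t hst ih =>
    by_cases hs : ∃ f, sent t f = some p
    · rw [Network.Injections.arrival, if_pos hs] at h
      omega
    · rw [Network.Injections.arrival, if_neg hs] at h
      rw [hops_succ_of_not_sent hs, ih h]

variable {π : Network.Protocol} (hrun : (injections num).IsRun π (fun p => route p.1.2) sent)

include hrun

theorem mem_queue_of_sent {t : ℕ} {f : forkNet.Link} {p : (injections num).Packet}
    (h : sent t f = some p) :
    p.1.1 ≤ t ∧ (route p.1.2)[(injections num).hops sent t p]? = some f :=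
  ((hrun t f).2 p h).1

theorem time_le_of_hops_pos {t : ℕ} {p : (injections num).Packet}
    (h : 0 < (injections num).hops sent t p) : p.1.1 ≤ t := by
  induction t with
  | zero => simp [Network.Injections.hops] at h
  | succ t ih =>
    by_cases hs : ∃ f, sent t f = some p
    · obtain ⟨f, hf⟩ := hs
      have := (mem_queue_of_sent hrun hf).1
      omega
    · rw [hops_succ_of_not_sent hs] at h
      have := ih h
      omega

theorem time_le_arrival {t : ℕ} {p : (injections num).Packet} :
    p.1.1 ≤ (injections num).arrival sent t p := by
  induction t with
  | zero => simp [Network.Injections.arrival]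
  | succ t ih =>
    rw [Network.Injections.arrival]
    split_ifs with hs
    · obtain ⟨f, hf⟩ := hs
      have := (mem_queue_of_sent hrun hf).1
      omega
    · exact ih

theorem finite_crossed (K : Kind) (i t : ℕ) : (crossed sent K i t).Finite :=
  (finite_setOf_time_le t).subset fun _ hp =>
    time_le_of_hops_pos hrun (lt_of_le_of_lt (Nat.zero_le _) hp.2)

omit hrun in
theorem finite_arrived (K : Kind) (i t : ℕ) : (arrived sent K i t).Finite :=
  (finite_setOf_time_le t).subset fun _ hp => hp.2.1

theorem crossed_subset_arrived (K : Kind) (i t : ℕ) :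
    crossed sent K i t ⊆ arrived sent K i t :=
  fun _ hp => ⟨hp.1, time_le_of_hops_pos hrun (lt_of_le_of_lt (Nat.zero_le _) hp.2), hp.2.le⟩

theorem arrived_succ (K : Kind) (i t : ℕ) :
    arrived sent K (i + 1) t = crossed sent K i t := by
  ext p
  constructor
  · rintro ⟨h1, h2, h3⟩
    exact ⟨h1, h3⟩
  · rintro ⟨h1, h2⟩
    exact ⟨h1, time_le_of_hops_pos hrun (lt_of_le_of_lt (Nat.zero_le _) h2), h2⟩

omit hrun in
theorem ncard_arrived_zero (K : Kind) (t : ℕ) :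
    (arrived sent K 0 t).ncard = ∑ u ∈ Finset.range (t + 1), num u K := by
  have : arrived sent K 0 t =
      {p : (injections num).Packet | p.1 ∈ Finset.range (t + 1) ×ˢ ({K} : Finset Kind)} := by
    ext p
    rw [Set.mem_ofPred_eq, Finset.mem_product, Finset.mem_range, Finset.mem_singleton,
      Nat.lt_succ_iff]
    exact ⟨fun h => ⟨h.2.1, h.1⟩, fun h => ⟨h.2, h.1, Nat.zero_le _⟩⟩
  rw [this, setOf_time_mem_eq, Finset.sum_product]
  simp

theorem crossed_succ_of_ne {K : Kind} {i t : ℕ} {f : forkNet.Link}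
    (hf : (route K)[i]? = some f)
    (h : ∀ p, sent t f = some p → ¬ (p.1.2 = K ∧ (injections num).hops sent t p = i)) :
    crossed sent K i (t + 1) = crossed sent K i t := by
  ext p
  constructor
  · rintro ⟨h1, h2⟩
    refine ⟨h1, ?_⟩
    by_contra h3
    by_cases hs : ∃ f, sent t f = some p
    · obtain ⟨f', hf'⟩ := hs
      rw [hops_succ_of_sent hf'] at h2
      have h4 : (injections num).hops sent t p = i := by omega
      have h5 := (mem_queue_of_sent hrun hf').2
      rw [h4, h1, hf] at h5
      obtain rfl : f = f' := Option.some_injective _ h5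
      exact h p hf' ⟨h1, h4⟩
    · rw [hops_succ_of_not_sent hs] at h2
      exact h3 h2
  · rintro ⟨h1, h2⟩
    exact ⟨h1, lt_of_lt_of_le h2 (hops_mono (Nat.le_succ t))⟩

theorem crossed_succ_of_sent {K : Kind} {i t : ℕ} {f : forkNet.Link}
    {p : (injections num).Packet} (hf : sent t f = some p) (hK : p.1.2 = K)
    (hi : (injections num).hops sent t p = i) :
    crossed sent K i (t + 1) = insert p (crossed sent K i t) := by
  ext x
  rw [Set.mem_insert_iff]
  constructor
  · rintro ⟨h1, h2⟩
    by_contra h3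
    rw [not_or] at h3
    by_cases hs : ∃ f, sent t f = some x
    · obtain ⟨f', hf'⟩ := hs
      rw [hops_succ_of_sent hf'] at h2
      have h4 : (injections num).hops sent t x = i := by
        have : ¬ i < (injections num).hops sent t x := fun h => h3.2 ⟨h1, h⟩
        omega
      have h5 := (mem_queue_of_sent hrun hf').2
      have h6 := (mem_queue_of_sent hrun hf).2
      rw [h4, h1] at h5
      rw [hi, hK, h5] at h6
      obtain rfl : f' = f := Option.some_injective _ h6
      rw [hf] at hf'
      exact h3.1 (Option.some_injective _ hf').symm
    · rw [hops_succ_of_not_sent hs] at h2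
      exact h3.2 ⟨h1, h2⟩
  · rintro (rfl | ⟨h1, h2⟩)
    · exact ⟨hK, by rw [hops_succ_of_sent hf]; omega⟩
    · exact ⟨h1, lt_of_lt_of_le h2 (hops_mono (Nat.le_succ t))⟩

theorem ncard_lt_of_mem {K : Kind} {i t : ℕ} {p : (injections num).Packet}
    (h : p ∈ arrived sent K i t) (h' : p ∉ crossed sent K i t) :
    (crossed sent K i t).ncard < (arrived sent K i t).ncard :=
  Set.ncard_lt_ncard ⟨crossed_subset_arrived hrun K i t, fun hs => h' (hs h)⟩
    (finite_arrived K i t)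

theorem ncard_eq_of_forall {K : Kind} {i t : ℕ} {f : forkNet.Link}
    (hf : (route K)[i]? = some f)
    (h : ∀ p ∈ (injections num).queue (fun p => route p.1.2) sent t f,
      ¬ (p.1.2 = K ∧ (injections num).hops sent t p = i)) :
    (arrived sent K i t).ncard = (crossed sent K i t).ncard := by
  congr 1
  refine Set.Subset.antisymm ?_ (crossed_subset_arrived hrun K i t)
  rintro p ⟨h1, h2, h3⟩
  refine ⟨h1, lt_of_le_of_ne h3 fun h4 => ?_⟩
  refine h p ⟨h2, ?_⟩ ⟨h1, h4.symm⟩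
  show (route p.1.2)[(injections num).hops sent t p]? = some f
  rw [← h4, h1, hf]

/-- A link sends at most one packet per step, and the kind and hop count of that packet determine
the only count that changes. All that later arguments need of a protocol is the priority clause of
`step` or the field `fifo`: if a packet that arrived after `τ` has crossed the link by `t`, then so
has every packet that was there by `τ`. -/
theorem isFlow_of_isRun :
    IsFlow num π (fun K i t => (arrived sent K i t).ncard)
      (fun K i t => (crossed sent K i t).ncard) where
  ar_zero := ncard_arrived_zero
  ar_succ K i t := by rw [arrived_succ hrun]
  cr_zero K i := by
    have : crossed sent K i 0 = ∅ := by
      ext p; simp [crossed, Network.Injections.hops]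
    rw [this, Set.ncard_empty]
  cr_le K i t _ := Set.ncard_le_ncard (crossed_subset_arrived hrun K i t) (finite_arrived K i t)
  step t f := by
    rcases hs : sent t f with _ | p
    · left
      intro K i hf
      have hq := (hrun t f).1 hs
      refine ⟨?_, ncard_eq_of_forall hrun hf (by rw [hq]; simp)⟩
      rw [crossed_succ_of_ne hrun hf]
      rintro p hp
      rw [hs] at hp
      cases hp
    · right
      have hp := mem_queue_of_sent hrun hs
      have hnot : p ∉ crossed sent p.1.2 ((injections num).hops sent t p) t :=
        fun h => lt_irrefl _ h.2
      refine ⟨p.1.2, (injections num).hops sent t p, hp.2, ?_, ?_, ?_⟩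
      · exact ncard_lt_of_mem hrun ⟨rfl, hp.1, le_rfl⟩ hnot
      · rw [crossed_succ_of_sent hrun hs rfl rfl,
          Set.ncard_insert_of_notMem hnot (finite_crossed hrun _ _ _)]
      · intro K' i' hf'
        constructor
        · intro hne
          rw [crossed_succ_of_ne hrun hf']
          rintro x hx ⟨h1, h2⟩
          rw [hs] at hx
          obtain rfl := Option.some_injective _ hx
          exact hne (by rw [h1, h2])
        · rintro rfl hlt
          refine ncard_eq_of_forall hrun hf' ?_
          rintro x hx ⟨h1, h2⟩
          have h3 := ((hrun t f).2 p hs).2 x hx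
          simp only [Network.Injections.rank, h1, h2] at h3
          omega
  fifo hπ f K i K' i' τ t hf hf' hlt := by
    subst hπ
    refine Set.ncard_le_ncard ?_ (finite_crossed hrun _ _ _)
    have : ¬ crossed sent K i t ⊆ arrived sent K i τ := fun hsub =>
      absurd (Set.ncard_le_ncard hsub (finite_arrived K i τ)) (by omega)
    rw [Set.not_subset] at this
    obtain ⟨p, ⟨hp1, hp2⟩, hp3⟩ := this
    rintro q ⟨hq1, hq2, hq3⟩
    refine ⟨hq1, ?_⟩
    by_contra hq4
    -- the time at which `p` crosses the link
    have hex : ∃ t, i < (injections num).hops sent t p := ⟨t, hp2⟩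
    classical
    have hT := Nat.find_spec hex
    have hTle : Nat.find hex ≤ t := Nat.find_min' hex hp2
    obtain ⟨T, hTeq⟩ : ∃ T, Nat.find hex = T + 1 := by
      refine ⟨Nat.find hex - 1, ?_⟩
      have : Nat.find hex ≠ 0 := by
        intro h0
        rw [h0] at hT
        simp [Network.Injections.hops] at hT
      omega
    have hTmin : ¬ i < (injections num).hops sent T p := Nat.find_min hex (by omega)
    rw [hTeq] at hT hTle
    have hsent : ∃ f, sent T f = some p := by
      by_contra hs
      rw [hops_succ_of_not_sent hs] at hT
      exact hTmin hT
    obtain ⟨f', hsf⟩ := hsent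
    rw [hops_succ_of_sent hsf] at hT
    have hTi : (injections num).hops sent T p = i := by omega
    have hmem := mem_queue_of_sent hrun hsf
    have hff : f' = f := by
      have := hmem.2
      rw [hTi, hp1, hf] at this
      exact (Option.some_injective _ this).symm
    subst hff
    -- Otherwise `p` would have reached link number `i` by time `τ`.
    have hτT : τ < T := by
      by_contra hle
      refine hp3 ⟨hp1, le_trans hmem.1 (by omega), ?_⟩
      have : (injections num).hops sent T p ≤ (injections num).hops sent τ p :=
        hops_mono (by omega)
      omega
    have hqT : (injections num).hops sent T q = i' := by
      have h1 : (injections num).hops sent τ q ≤ (injections num).hops sent T q :=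
        hops_mono hτT.le
      have h2 : (injections num).hops sent T q ≤ (injections num).hops sent t q :=
        hops_mono (by omega)
      omega
    have hqτ : (injections num).hops sent τ q = i' := by
      have h1 : (injections num).hops sent τ q ≤ (injections num).hops sent T q :=
        hops_mono hτT.le
      omega
    -- Packet `q` is still in the queue at `T` and arrived by `τ`. Minimal rank then forces `p` to
    -- have arrived by `τ` as well, which is the contradiction.
    have hrank := ((hrun T f').2 p hsf).2 q ⟨by
      show q.1.1 ≤ T
      omega, by
      show (route q.1.2)[(injections num).hops sent T q]? = some f'
      rw [hqT, hq1, hf']⟩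
    simp only [Network.Injections.rank] at hrank
    rw [arrival_eq_of_hops_eq (s := τ) hτT.le (hqT.trans hqτ.symm)] at hrank
    have h1 : (injections num).arrival sent τ q ≤ τ := by
      have := arrival_le (sent := sent) (t := τ) (p := q)
      omega
    have h2 : (injections num).arrival sent T p ≤ τ := hrank.trans h1
    refine hp3 ⟨hp1, (time_le_arrival hrun).trans h2, ?_⟩
    rw [← hops_eq_of_arrival_le hτT.le h2, hTi]

/-- An injected packet of kind `K` that has not crossed link number `i` of its route is still
undelivered. -/
theorem ncard_arrived_zero_le {K : Kind} {i t : ℕ} (hi : i < (route K).length) :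
    (arrived sent K 0 t).ncard ≤ (crossed sent K i t).ncard +
      (injections num).numPackets (fun p => route p.1.2) sent t := by
  refine le_trans (Set.ncard_le_ncard ?_ ?_) (Set.ncard_union_le _ _)
  · rintro p ⟨h1, h2, _⟩
    by_cases h : i < (injections num).hops sent t p
    · exact Or.inl ⟨h1, h⟩
    · refine Or.inr ⟨h2, ?_⟩
      show _ < (route p.1.2).length
      rw [h1]
      omega
  · exact (finite_crossed hrun _ _ _).union
      ((finite_setOf_time_le t).subset fun _ hp => hp.1)

end Run

/-! ### Links as servers -/

/-- A server with arrivals `A` and services `a`, cumulative counts. -/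
def Single (A a : ℕ → ℕ) : Prop :=
  ∀ t, (a t < A t ∧ a (t + 1) = a t + 1) ∨ (a t = A t ∧ a (t + 1) = a t)

/-- A server with two classes of arrivals `A`, `B` and services `a`, `b`, where the first class
has priority. -/
def Prio (A a B b : ℕ → ℕ) : Prop :=
  ∀ t, (a t < A t ∧ a (t + 1) = a t + 1 ∧ b (t + 1) = b t ∧ b t ≤ B t) ∨
    (a t = A t ∧ a (t + 1) = a t ∧
      ((b t < B t ∧ b (t + 1) = b t + 1) ∨ (b t = B t ∧ b (t + 1) = b t)))

/-- A first-in-first-out server with two classes of arrivals `A`, `B` and services `a`, `b`. -/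
structure Fifo (A a B b : ℕ → ℕ) : Prop where
  step : ∀ t, a t ≤ A t ∧ b t ≤ B t ∧ a t ≤ a (t + 1) ∧ b t ≤ b (t + 1) ∧
    ((a t + b t < A t + B t ∧ a (t + 1) + b (t + 1) = a t + b t + 1) ∨
      (a t + b t = A t + B t ∧ a (t + 1) + b (t + 1) = a t + b t))
  comp : ∀ τ t, (a t ≤ A τ ∧ b t ≤ B τ) ∨ (A τ ≤ a t ∧ B τ ≤ b t)

theorem List.sum_map_eq_add_one {α : Type*} {l : List α} (hl : l.Nodup) {f g : α → ℕ} {s : α}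
    (hs : s ∈ l) (h : g s = f s + 1) (h' : ∀ x ∈ l, x ≠ s → g x = f x) :
    (l.map g).sum = (l.map f).sum + 1 := by
  induction l with
  | nil => simp at hs
  | cons x l ih =>
    rw [List.nodup_cons] at hl
    simp only [List.map_cons, List.sum_cons]
    rcases List.mem_cons.1 hs with rfl | hs'
    · have : l.map g = l.map f := List.map_congr_left fun y hy =>
        h' y (List.mem_cons_of_mem _ hy) (by rintro rfl; exact hl.1 hy)
      rw [this, h]; omega
    · rw [ih hl.2 hs' fun y hy => h' y (List.mem_cons_of_mem _ hy),
        h' x (by simp) (by rintro rfl; exact hl.1 hs')]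
      omega

theorem List.sum_map_lt {α : Type*} {l : List α} {f g : α → ℕ} {s : α}
    (hs : s ∈ l) (h : f s < g s) (h' : ∀ x ∈ l, f x ≤ g x) :
    (l.map f).sum < (l.map g).sum := by
  induction l with
  | nil => simp at hs
  | cons x l ih =>
    simp only [List.map_cons, List.sum_cons]
    have hx := h' x (by simp)
    rcases List.mem_cons.1 hs with rfl | hs'
    · have := List.sum_le_sum fun y hy => h' y (List.mem_cons_of_mem _ hy)
      omega
    · have := ih hs' fun y hy => h' y (List.mem_cons_of_mem _ hy)
      omega

section Flow

variable {num : ℕ → Kind → ℕ} {π : Network.Protocol} {ar cr : Kind → ℕ → ℕ → ℕ}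

/-- The total count over a list of streams. -/
def total (c : Kind → ℕ → ℕ → ℕ) (L : List (Kind × ℕ)) (t : ℕ) : ℕ :=
  (L.map fun s => c s.1 s.2 t).sum

namespace IsFlow

variable (F : IsFlow num π ar cr)
include F

theorem cr_le_of_mem {f : Bool × Arc} {L : List (Kind × ℕ)}
    (hL : ∀ s ∈ L, (route s.1)[s.2]? = some f) (t : ℕ) (s : Kind × ℕ) (hs : s ∈ L) :
    cr s.1 s.2 t ≤ ar s.1 s.2 t :=
  F.cr_le _ _ _ (List.getElem?_eq_some_iff.1 (hL s hs)).1

theorem total_le {f : Bool × Arc} {L : List (Kind × ℕ)}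
    (hL : ∀ s ∈ L, (route s.1)[s.2]? = some f) (t : ℕ) :
    total cr L t ≤ total ar L t :=
  List.sum_le_sum fun s hs => F.cr_le_of_mem hL t s hs

/-- Arbitrary tie-breaking leaves the individual streams undetermined, but the totals over two
groups that exhaust the streams of a link behave like a two-class server: it serves the first group,
serves the second, or is empty. -/
theorem total_step {f : Bool × Arc} {H L : List (Kind × ℕ)} (hn : (H ++ L).Nodup)
    (h : ∀ K i, (route K)[i]? = some f ↔ (K, i) ∈ H ++ L) (t : ℕ) :
    (total cr H t < total ar H t ∧ total cr H (t + 1) = total cr H t + 1 ∧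
      total cr L (t + 1) = total cr L t ∧ total cr L t ≤ total ar L t) ∨
    ((π = .ntg → (∀ s ∈ H, ∀ s' ∈ L, (route s.1).length - s.2 < (route s'.1).length - s'.2) →
        total cr H t = total ar H t) ∧
      total cr H t ≤ total ar H t ∧ total cr H (t + 1) = total cr H t ∧
      total cr L t < total ar L t ∧ total cr L (t + 1) = total cr L t + 1) ∨
    (total cr H t = total ar H t ∧ total cr H (t + 1) = total cr H t ∧
      total cr L t = total ar L t ∧ total cr L (t + 1) = total cr L t) := by
  have hH : ∀ s ∈ H, (route s.1)[s.2]? = some f := fun s hs => (h s.1 s.2).2 (by simp [hs])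
  have hL : ∀ s ∈ L, (route s.1)[s.2]? = some f := fun s hs => (h s.1 s.2).2 (by simp [hs])
  have hn' := List.nodup_append.1 hn
  rcases F.step t f with h0 | ⟨K, i, hf, hlt, hsucc, hrest⟩
  · right; right
    refine ⟨?_, ?_, ?_, ?_⟩ <;>
      refine congrArg List.sum (List.map_congr_left fun s hs => ?_)
    · exact (h0 _ _ (hH s hs)).2.symm
    · exact (h0 _ _ (hH s hs)).1
    · exact (h0 _ _ (hL s hs)).2.symm
    · exact (h0 _ _ (hL s hs)).1
  · rcases List.mem_append.1 ((h K i).1 hf) with hm | hm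
    · left
      refine ⟨List.sum_map_lt hm hlt (F.cr_le_of_mem hH t),
        List.sum_map_eq_add_one hn'.1 hm hsucc fun s hs hne => (hrest _ _ (hH s hs)).1 hne,
        congrArg List.sum (List.map_congr_left fun s hs => ?_), F.total_le hL t⟩
      exact (hrest _ _ (hL s hs)).1 fun he => hn'.2.2 (K, i) hm s hs he.symm
    · right; left
      refine ⟨fun hπ hp => ?_, F.total_le hH t, ?_, List.sum_map_lt hm hlt (F.cr_le_of_mem hL t),
        List.sum_map_eq_add_one hn'.2.1 hm hsucc fun s hs hne => (hrest _ _ (hL s hs)).1 hne⟩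
      · refine congrArg List.sum (List.map_congr_left fun s hs => ?_)
        exact ((hrest _ _ (hH s hs)).2 hπ (hp s hs (K, i) hm)).symm
      · refine congrArg List.sum (List.map_congr_left fun s hs => ?_)
        exact (hrest _ _ (hH s hs)).1 fun he => hn'.2.2 s hs (K, i) hm he

theorem prio {f : Bool × Arc} {H L : List (Kind × ℕ)} (hπ : π = .ntg) (hn : (H ++ L).Nodup)
    (h : ∀ K i, (route K)[i]? = some f ↔ (K, i) ∈ H ++ L)
    (hp : ∀ s ∈ H, ∀ s' ∈ L, (route s.1).length - s.2 < (route s'.1).length - s'.2) :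
    Prio (total ar H) (total cr H) (total ar L) (total cr L) := by
  intro t
  rcases F.total_step hn h t with h1 | ⟨h1, h2⟩ | h1
  · left; omega
  · have := h1 hπ hp
    right; omega
  · right; omega

theorem single {f : Bool × Arc} {H : List (Kind × ℕ)} (hn : H.Nodup)
    (h : ∀ K i, (route K)[i]? = some f ↔ (K, i) ∈ H) :
    Single (total ar H) (total cr H) := by
  intro t
  have h3 : ∀ c, total c [] t = 0 := fun c => rfl
  have h4 := h3 ar
  have h5 := h3 cr
  rcases F.total_step (H := H) (L := []) (by simpa using hn) (by simpa using h) t with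
    h1 | ⟨h1, h2⟩ | h1
  · left; omega
  · omega
  · right; omega

theorem fifo_server {f : Bool × Arc} {H L : List (Kind × ℕ)} (hπ : π = .fifo)
    (hn : (H ++ L).Nodup) (h : ∀ K i, (route K)[i]? = some f ↔ (K, i) ∈ H ++ L) :
    Fifo (total ar H) (total cr H) (total ar L) (total cr L) where
  step t := by
    rcases F.total_step hn h t with h1 | ⟨h1, h2⟩ | h1 <;> omega
  comp τ t := by
    have hH : ∀ s ∈ H, (route s.1)[s.2]? = some f := fun s hs => (h s.1 s.2).2 (by simp [hs])
    have hL : ∀ s ∈ L, (route s.1)[s.2]? = some f := fun s hs => (h s.1 s.2).2 (by simp [hs])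
    by_cases hc : ∃ K i, (route K)[i]? = some f ∧ ar K i τ < cr K i t
    · obtain ⟨K, i, hf, hlt⟩ := hc
      right
      exact ⟨List.sum_le_sum fun s hs => F.fifo hπ f K i _ _ τ t hf (hH s hs) hlt,
        List.sum_le_sum fun s hs => F.fifo hπ f K i _ _ τ t hf (hL s hs) hlt⟩
    · push Not at hc
      left
      exact ⟨List.sum_le_sum fun s hs => hc _ _ (hH s hs),
        List.sum_le_sum fun s hs => hc _ _ (hL s hs)⟩

end IsFlow

/-- The packets of the kinds `X`, `Y`, `V` of one half that have crossed the link `e` of the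
other half `h`. -/
def Se (cr : Kind → ℕ → ℕ → ℕ) (h : Bool) (t : ℕ) : ℕ :=
  cr (!h, .X) 2 t + cr (!h, .Y) 2 t + cr (!h, .V) 0 t

/-- `Se`, `Sl` and `Sg` count the same aggregated stream behind `e`, `l` and `g`. The three kinds
have equally many hops to go on these links, so nearest-to-go does not separate them. -/
def Sl (cr : Kind → ℕ → ℕ → ℕ) (h : Bool) (t : ℕ) : ℕ :=
  cr (!h, .X) 3 t + cr (!h, .Y) 3 t + cr (!h, .V) 1 t

def Sg (cr : Kind → ℕ → ℕ → ℕ) (h : Bool) (t : ℕ) : ℕ :=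
  cr (!h, .X) 4 t + cr (!h, .Y) 4 t + cr (!h, .V) 2 t

/-- The packets of kinds `X`, `Y`, `V` that have reached the link `e` of the half `h`. -/
def Sa (ar cr : Kind → ℕ → ℕ → ℕ) (h : Bool) (t : ℕ) : ℕ :=
  cr (!h, .X) 1 t + cr (!h, .Y) 1 t + ar (!h, .V) 0 t

/-- This lemma and its analogues below list all streams of each link. Where the list is split, the
first part is nearer to its destination, so the same split serves nearest-to-go and
first-in-first-out. -/
theorem route_e_iff (h : Bool) (K : Kind) (i : ℕ) : (route K)[i]? = some (h, Arc.e) ↔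
    (K, i) ∈ ([((!h, .X), 2), ((!h, .Y), 2), ((!h, .V), 0)] ++ [((h, .W), 0)] :
      List (Kind × ℕ)) := by
  rcases K with ⟨b, K⟩
  rcases i with _ | _ | _ | _ | _ | i <;> cases K <;> cases b <;> cases h <;> simp [route]

theorem route_l_iff (h : Bool) (K : Kind) (i : ℕ) : (route K)[i]? = some (h, Arc.l) ↔
    (K, i) ∈ ([((!h, .X), 3), ((!h, .Y), 3), ((!h, .V), 1)] : List (Kind × ℕ)) := by
  rcases K with ⟨b, K⟩
  rcases i with _ | _ | _ | _ | _ | i <;> cases K <;> cases b <;> cases h <;> simp [route]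

theorem route_g_iff (h : Bool) (K : Kind) (i : ℕ) : (route K)[i]? = some (h, Arc.g) ↔
    (K, i) ∈ ([((!h, .X), 4), ((!h, .Y), 4), ((!h, .V), 2), ((h, .Zg), 0)] ++ [((h, .X), 0)] :
      List (Kind × ℕ)) := by
  rcases K with ⟨b, K⟩
  rcases i with _ | _ | _ | _ | _ | i <;> cases K <;> cases b <;> cases h <;> simp [route]

theorem route_x_iff (h : Bool) (K : Kind) (i : ℕ) : (route K)[i]? = some (h, Arc.x) ↔
    (K, i) ∈ ([((h, .Zx), 0)] ++ [((h, .X), 1)] : List (Kind × ℕ)) := by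
  rcases K with ⟨b, K⟩
  rcases i with _ | _ | _ | _ | _ | i <;> cases K <;> cases b <;> cases h <;> simp [route]

theorem route_y_iff (h : Bool) (K : Kind) (i : ℕ) : (route K)[i]? = some (h, Arc.y) ↔
    (K, i) ∈ ([((h, .W), 3), ((h, .Zy), 0)] ++ [((h, .Y), 0)] : List (Kind × ℕ)) := by
  rcases K with ⟨b, K⟩
  rcases i with _ | _ | _ | _ | _ | i <;> cases K <;> cases b <;> cases h <;> simp [route]

theorem route_k_iff (h : Bool) (K : Kind) (i : ℕ) : (route K)[i]? = some (h, Arc.k) ↔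
    (K, i) ∈ ([((h, .W), 1)] : List (Kind × ℕ)) := by
  rcases K with ⟨b, K⟩
  rcases i with _ | _ | _ | _ | _ | i <;> cases K <;> cases b <;> cases h <;> simp [route]

theorem route_j_iff (h : Bool) (K : Kind) (i : ℕ) : (route K)[i]? = some (h, Arc.j) ↔
    (K, i) ∈ ([((h, .W), 2)] : List (Kind × ℕ)) := by
  rcases K with ⟨b, K⟩
  rcases i with _ | _ | _ | _ | _ | i <;> cases K <;> cases b <;> cases h <;> simp [route]

theorem route_m_iff (h : Bool) (K : Kind) (i : ℕ) : (route K)[i]? = some (h, Arc.m) ↔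
    (K, i) ∈ ([((h, .Y), 1)] : List (Kind × ℕ)) := by
  rcases K with ⟨b, K⟩
  rcases i with _ | _ | _ | _ | _ | i <;> cases K <;> cases b <;> cases h <;> simp [route]

namespace IsFlow

variable (F : IsFlow num π ar cr)
include F

theorem single_l (h : Bool) : Single (Se cr h) (Sl cr h) := by
  have := F.single (by simp) (route_l_iff h)
  convert this using 1 <;> funext t <;> simp [total, Se, Sl, F.ar_succ, add_assoc]

theorem single_k (h : Bool) : Single (cr (h, .W) 0) (cr (h, .W) 1) := by
  have := F.single (by simp) (route_k_iff h)
  convert this using 1 <;> funext t <;> simp [total, F.ar_succ]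

theorem single_j (h : Bool) : Single (cr (h, .W) 1) (cr (h, .W) 2) := by
  have := F.single (by simp) (route_j_iff h)
  convert this using 1 <;> funext t <;> simp [total, F.ar_succ]

theorem single_m (h : Bool) : Single (cr (h, .Y) 0) (cr (h, .Y) 1) := by
  have := F.single (by simp) (route_m_iff h)
  convert this using 1 <;> funext t <;> simp [total, F.ar_succ]

theorem prio_e (hπ : π = .ntg) (h : Bool) :
    Prio (Sa ar cr h) (Se cr h) (ar (h, .W) 0) (cr (h, .W) 0) := by
  have := F.prio hπ (by cases h <;> simp) (route_e_iff h) (by simp [route])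
  convert this using 1 <;> funext t <;> simp [total, Se, Sa, F.ar_succ, add_assoc]

theorem prio_g (hπ : π = .ntg) (h : Bool) :
    Prio (fun t => Sl cr h t + ar (h, .Zg) 0 t) (fun t => Sg cr h t + cr (h, .Zg) 0 t)
      (ar (h, .X) 0) (cr (h, .X) 0) := by
  have := F.prio hπ (by cases h <;> simp) (route_g_iff h) (by simp [route])
  convert this using 1 <;> funext t <;> simp [total, Sl, Sg, F.ar_succ, add_assoc]

theorem prio_x (hπ : π = .ntg) (h : Bool) :
    Prio (ar (h, .Zx) 0) (cr (h, .Zx) 0) (cr (h, .X) 0) (cr (h, .X) 1) := by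
  have := F.prio hπ (by cases h <;> simp) (route_x_iff h) (by simp [route])
  convert this using 1 <;> funext t <;> simp [total, F.ar_succ]

theorem prio_y (hπ : π = .ntg) (h : Bool) :
    Prio (fun t => cr (h, .W) 2 t + ar (h, .Zy) 0 t) (fun t => cr (h, .W) 3 t + cr (h, .Zy) 0 t)
      (ar (h, .Y) 0) (cr (h, .Y) 0) := by
  have := F.prio hπ (by cases h <;> simp) (route_y_iff h) (by simp [route])
  convert this using 1 <;> funext t <;> simp [total, F.ar_succ]

theorem fifo_e (hπ : π = .fifo) (h : Bool) :
    Fifo (Sa ar cr h) (Se cr h) (ar (h, .W) 0) (cr (h, .W) 0) := by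
  have := F.fifo_server hπ (by cases h <;> simp) (route_e_iff h)
  convert this using 1 <;> funext t <;> simp [total, Se, Sa, F.ar_succ, add_assoc]

theorem fifo_g (hπ : π = .fifo) (h : Bool) :
    Fifo (fun t => Sl cr h t + ar (h, .Zg) 0 t) (fun t => Sg cr h t + cr (h, .Zg) 0 t)
      (ar (h, .X) 0) (cr (h, .X) 0) := by
  have := F.fifo_server hπ (by cases h <;> simp) (route_g_iff h)
  convert this using 1 <;> funext t <;> simp [total, Sl, Sg, F.ar_succ, add_assoc]

theorem fifo_x (hπ : π = .fifo) (h : Bool) :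
    Fifo (ar (h, .Zx) 0) (cr (h, .Zx) 0) (cr (h, .X) 0) (cr (h, .X) 1) := by
  have := F.fifo_server hπ (by cases h <;> simp) (route_x_iff h)
  convert this using 1 <;> funext t <;> simp [total, F.ar_succ]

theorem fifo_y (hπ : π = .fifo) (h : Bool) :
    Fifo (fun t => cr (h, .W) 2 t + ar (h, .Zy) 0 t) (fun t => cr (h, .W) 3 t + cr (h, .Zy) 0 t)
      (ar (h, .Y) 0) (cr (h, .Y) 0) := by
  have := F.fifo_server hπ (by cases h <;> simp) (route_y_iff h)
  convert this using 1 <;> funext t <;> simp [total, F.ar_succ]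

end IsFlow

end Flow

/-! ### Injection in phases -/

/-- The injections proceed in phases; phase `k` starts at time `T k` and injects packets into the
half `k.bodd`, at rate `p / q`, those of load `L` in the window `[T k + lo k L, T k + hi k L)`.
In addition there is a burst of `s` packets at time `0`. -/
noncomputable def schedule (p q s : ℕ) (T : ℕ → ℕ) (lo hi : ℕ → Load → ℕ) (t : ℕ) (K : Kind) : ℕ :=
  open scoped Classical in
  (if t % q < p ∧ ∃ k : ℕ, K.1 = k.bodd ∧ T k + lo k K.2 ≤ t ∧ t < T k + hi k K.2
    then 1 else 0) + if t = 0 ∧ K = (true, .V) then s else 0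

/-- The windows lie within their phases, and those of loads that share a link are disjoint. -/
structure IsSchedule (T : ℕ → ℕ) (lo hi : ℕ → Load → ℕ) : Prop where
  mono : Monotone T
  lo_pos : ∀ k L, 0 < lo k L
  hi_le : ∀ k L, T k + hi k L ≤ T (k + 1)
  disjoint : ∀ k L L', L ≠ L' → (∃ h f, f ∈ route (h, L) ∧ f ∈ route (h, L')) →
    hi k L ≤ lo k L' ∨ hi k L' ≤ lo k L

theorem IsSchedule.unique {T : ℕ → ℕ} {lo hi : ℕ → Load → ℕ} (S : IsSchedule T lo hi)
    {k k' t : ℕ} {L : Load} (h1 : T k + lo k L ≤ t) (h2 : t < T k + hi k L)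
    (h3 : T k' < t) (h4 : t ≤ T (k' + 1)) : k = k' := by
  have h5 := S.hi_le k L
  have h6 := S.lo_pos k L
  rcases lt_trichotomy k k' with h | h | h
  · have := S.mono (show k + 1 ≤ k' from h)
    omega
  · exact h
  · have := S.mono (show k' + 1 ≤ k from h)
    omega

/-- A time determines its phase, hence the half that receives packets, and loads that share a link
have disjoint windows. So at most one scheduled packet per slot has a route through a given link. -/
theorem IsSchedule.admissible {T : ℕ → ℕ} {lo hi : ℕ → Load → ℕ} (S : IsSchedule T lo hi)
    {p q s : ℕ} {r : ℝ} (hp : p ≤ q) (hq : 0 < q) (hr : (p : ℝ) / q < r) :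
    ∃ w : ℕ, 0 < w ∧ (injections (schedule p q s T lo hi)).Admissible w r := by
  refine admissible_of_slots (s := s) hp hq hr fun t f => ?_
  classical
  simp only [schedule]
  rw [Finset.sum_add_distrib]
  refine Nat.add_le_add ?_ ?_
  · by_cases ht : t % q < p
    · simp only [ht, true_and, if_true]
      rw [← Finset.card_filter, Finset.card_le_one]
      rintro ⟨h, L⟩ hK ⟨h', L'⟩ hK'
      simp only [Finset.mem_filter, Finset.mem_univ, true_and] at hK hK'
      obtain ⟨hf, k, hk, h1, h2⟩ := hK
      obtain ⟨hf', k', hk', h1', h2'⟩ := hK'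
      have h3 := S.hi_le k' L'
      have h4 := S.lo_pos k' L'
      obtain rfl : k = k' := S.unique h1 h2 (by omega) (by omega)
      obtain rfl : h = h' := hk.trans hk'.symm
      by_contra hne
      have := S.disjoint k L L' (fun hL => hne (by rw [hL])) ⟨h, f, hf, hf'⟩
      omega
    · simp [ht]
  · by_cases ht : t = 0
    · simp only [ht, true_and, if_true]
      refine (Finset.sum_le_sum_of_subset (Finset.filter_subset _ _)).trans ?_
      rw [Finset.sum_ite_eq']
      simp
    · simp [ht]

/-- From time `t₀` to time `t₁` the cumulative count `I` increases at rate `p / q` in the window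
`[u, v)`, and only there. -/
def Pulse (I : ℕ → ℕ) (p q t₀ t₁ u v : ℕ) : Prop :=
  ∀ t, t₀ ≤ t → t ≤ t₁ → I t = I t₀ + slots p q u (min (t + 1) v)

theorem slots_of_le {p q u v : ℕ} (h : v ≤ u) : slots p q u v = 0 := by
  simp [slots, Finset.Ico_eq_empty_of_le h]

namespace Pulse

variable {I : ℕ → ℕ} {p q t₀ t₁ u v : ℕ}

theorem before (P : Pulse I p q t₀ t₁ u v) {t : ℕ} (h : t₀ ≤ t) (h' : t ≤ t₁) (hu : t < u) :
    I t = I t₀ := by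
  rw [P t h h', slots_of_le (by omega), add_zero]

theorem after (hp : p ≤ q) {j : ℕ} (P : Pulse I p q t₀ t₁ u (u + q * j)) {t : ℕ} (h : t₀ ≤ t)
    (h' : t ≤ t₁) (hu : u + q * j ≤ t + 1) : I t = I t₀ + p * j := by
  rw [P t h h', min_eq_right hu, slots_mul hp]

theorem mono (P : Pulse I p q t₀ t₁ u v) {s t : ℕ} (h : t₀ ≤ s) (hst : s ≤ t) (h' : t ≤ t₁) :
    I s ≤ I t := by
  rw [P t (by omega) h', P s h (by omega)]
  have := slots_mono (p := p) (q := q) (le_refl u)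
    (show min (s + 1) v ≤ min (t + 1) v by omega)
  omega

theorem step_le (P : Pulse I p q t₀ t₁ u v) {t : ℕ} (h : t₀ ≤ t) (h' : t + 1 ≤ t₁) :
    I (t + 1) ≤ I t + 1 := by
  rw [P t h (by omega), P (t + 1) (by omega) h']
  by_cases h1 : u ≤ t + 1
  · by_cases h2 : t + 1 < v
    · rw [min_eq_left (show t + 1 + 1 ≤ v by omega), min_eq_left (show t + 1 ≤ v by omega),
        slots_succ h1]
      split_ifs <;> omega
    · rw [min_eq_right (show v ≤ t + 1 + 1 by omega), min_eq_right (show v ≤ t + 1 by omega)]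
      omega
  · rw [slots_of_le (v := min (t + 1 + 1) v) (by omega)]
    omega

end Pulse

section Phase

variable {p q s : ℕ} {T : ℕ → ℕ} {lo hi : ℕ → Load → ℕ} {π : Network.Protocol}
  {ar cr : Kind → ℕ → ℕ → ℕ}

theorem IsFlow.ar_zero_succ {num : ℕ → Kind → ℕ} (F : IsFlow num π ar cr) (K : Kind) (t : ℕ) :
    ar K 0 (t + 1) = ar K 0 t + num (t + 1) K := by
  rw [F.ar_zero, F.ar_zero, Finset.sum_range_succ]

/-- The bound `min (t + 1)` in `Pulse` appears because the count at time `t` includes the packets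
injected at `t`. -/
theorem IsFlow.pulse (S : IsSchedule T lo hi) (F : IsFlow (schedule p q s T lo hi) π ar cr)
    (k : ℕ) (L : Load) : Pulse (ar (k.bodd, L) 0) p q (T k) (T (k + 1)) (T k + lo k L)
      (T k + hi k L) := by
  intro t ht
  have hlo := S.lo_pos k L
  have hhi := S.hi_le k L
  induction t, ht using Nat.le_induction with
  | base =>
    intro _
    rw [slots_of_le (by omega), add_zero]
  | succ t ht ih =>
    intro h
    rw [F.ar_zero_succ, ih (by omega), add_assoc]
    congr 1
    classical
    have : schedule p q s T lo hi (t + 1) (k.bodd, L) =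
        if (t + 1) % q < p ∧ T k + lo k L ≤ t + 1 ∧ t + 1 < T k + hi k L then 1 else 0 := by
      rw [schedule, if_neg (c := t + 1 = 0 ∧ _) (by omega), add_zero]
      refine if_congr (and_congr_right fun _ => ?_) rfl rfl
      constructor
      · rintro ⟨k', _, h1, h2⟩
        obtain rfl := S.unique h1 h2 (show T k < t + 1 by omega) h
        exact ⟨h1, h2⟩
      · rintro ⟨h1, h2⟩
        exact ⟨k, rfl, h1, h2⟩
    rw [this]
    by_cases h1 : T k + lo k L ≤ t + 1
    · by_cases h2 : t + 1 < T k + hi k L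
      · rw [min_eq_left (show t + 1 + 1 ≤ T k + hi k L by omega),
          min_eq_left (show t + 1 ≤ T k + hi k L by omega), slots_succ h1]
        simp [h1, h2]
      · rw [min_eq_right (show T k + hi k L ≤ t + 1 + 1 by omega),
          min_eq_right (show T k + hi k L ≤ t + 1 by omega)]
        simp [h2]
    · rw [slots_of_le (by omega), slots_of_le (by omega)]
      simp [h1]

theorem IsFlow.idle_half (S : IsSchedule T lo hi) (F : IsFlow (schedule p q s T lo hi) π ar cr)
    (k : ℕ) (L : Load) {t : ℕ} (ht : T k ≤ t) (ht' : t ≤ T (k + 1)) :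
    ar (!k.bodd, L) 0 t = ar (!k.bodd, L) 0 (T k) := by
  induction t, ht using Nat.le_induction with
  | base => rfl
  | succ t ht ih =>
    rw [F.ar_zero_succ, ih (by omega)]
    have : schedule p q s T lo hi (t + 1) (!k.bodd, L) = 0 := by
      rw [schedule, if_neg (c := t + 1 = 0 ∧ _) (by omega), if_neg]
      rintro ⟨_, k', h0, h1, h2⟩
      obtain rfl := S.unique h1 h2 (show T k < t + 1 by omega) ht'
      simp at h0
    omega

theorem IsFlow.ar_zero_start (F : IsFlow (schedule p q s T lo hi) π ar cr)
    (S : IsSchedule T lo hi) (K : Kind) :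
    ar K 0 0 = if K = (true, .V) then s else 0 := by
  classical
  rw [F.ar_zero, zero_add, Finset.sum_range_one, schedule, if_neg (c := _ ∧ ∃ _, _)]
  · simp
  · rintro ⟨_, k, _, h1, h2⟩
    have := S.lo_pos k K.2
    omega

/-- The packets of kinds `X`, `Y`, `V` that have been injected and cross the half `h` last. -/
def Stot (ar : Kind → ℕ → ℕ → ℕ) (h : Bool) (t : ℕ) : ℕ :=
  ar (!h, .X) 0 t + ar (!h, .Y) 0 t + ar (!h, .V) 0 t

/-- Packets injected for the aggregated stream that have not yet crossed `e` are undelivered, so it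
is enough that their number is unbounded. -/
theorem unstable_of_flow {num : ℕ → Kind → ℕ}
    (h : ∀ ar cr, IsFlow num π ar cr → ∀ B, ∃ t h, Se cr h t + B ≤ Stot ar h t) :
    Network.UnstableForAllRoutes forkNet π (injections num) := by
  intro ρ hρ sent hrun B
  rw [isRouting_iff] at hρ
  subst hρ
  obtain ⟨t, b, ht⟩ := h _ _ (isFlow_of_isRun hrun) (3 * B + 3)
  refine ⟨t, ?_⟩
  have h1 := ncard_arrived_zero_le hrun (K := (!b, .X)) (i := 2) (t := t) (by simp [route])
  have h2 := ncard_arrived_zero_le hrun (K := (!b, .Y)) (i := 2) (t := t) (by simp [route])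
  have h3 := ncard_arrived_zero_le hrun (K := (!b, .V)) (i := 0) (t := t) (by simp [route])
  simp only [Se, Stot] at ht
  omega

end Phase

/-! ### Servers without and with priorities -/

namespace Single

variable {A a : ℕ → ℕ}

/-- When at most one packet arrives per step, nothing ever queues, and the output is the input
shifted by one step. -/
theorem delay (h : Single A a) (h0 : A 0 = 0) (ha : a 0 = 0)
    (hA : ∀ t, A t ≤ A (t + 1) ∧ A (t + 1) ≤ A t + 1) (t : ℕ) : a (t + 1) = A t := by
  induction t with
  | zero => have := h 0; omega
  | succ t ih => have := h (t + 1); have := hA t; omega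

theorem le_succ (h : Single A a) (t : ℕ) : a t ≤ a (t + 1) ∧ a (t + 1) ≤ a t + 1 := by
  have := h t; omega

theorem mono (h : Single A a) : Monotone a :=
  monotone_nat_of_le_succ fun t => (h.le_succ t).1

end Single

namespace Prio

variable {A a B b : ℕ → ℕ}

theorem single (h : Prio A a B b) : Single A a := by
  intro t; have := h t; omega

theorem le_succ (h : Prio A a B b) (t : ℕ) : b t ≤ b (t + 1) ∧ b (t + 1) ≤ b t + 1 := by
  have := h t; omega

theorem mono (h : Prio A a B b) : Monotone b :=
  monotone_nat_of_le_succ fun t => (h.le_succ t).1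

/-- If the arrivals of the first class do not pause before all `N` of them have come, then this
class is served without a pause. -/
theorem drain (h : Prio A a B b) {t₀ t₁ N w : ℕ} (h01 : t₀ + 2 + N ≤ t₁ + a t₀)
    (hA : ∀ t, t₀ ≤ t → t ≤ t₁ → A t ≤ N)
    (hfeed : ∀ t, t₀ < t → t < t₁ → A t < A (t + 1) ∨ A (t + 1) = N)
    (hB0 : ∀ t, t₀ ≤ t → t < t₀ + 2 → B t = b t₀)
    (hB1 : ∀ t, t₀ + N ≤ t + a t₀ → t ≤ t₁ → B t = b t₀ + w)
    (hN : a t₀ + 2 ≤ N) :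
    ∃ f, t₀ + N ≤ f + a t₀ ∧ f + a t₀ ≤ t₀ + N + 2 ∧
      (∀ t, t₀ + 2 ≤ t → t < f → a (t + 1) = a t + 1) ∧
      (∀ t, t₀ ≤ t → t ≤ f → b t = b t₀) ∧
      (∀ t, f ≤ t → t ≤ t₁ → a t = N ∧ b t = b t₀ + min w (t - f)) := by
  have hs0 := h t₀
  have hs1 := h (t₀ + 1)
  have hB00 := hB0 t₀ (by omega) (by omega)
  have hB01 := hB0 (t₀ + 1) (by omega) (by omega)
  have hA0 := hA t₀ (by omega) (by omega)
  have hA1 := hA (t₀ + 1) (by omega) (by omega)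
  have hA2 := hA (t₀ + 2) (by omega) (by omega)
  rw [show t₀ + 1 + 1 = t₀ + 2 by omega] at hs1
  have hf1 := hfeed (t₀ + 1) (by omega) (by omega)
  rw [show t₀ + 1 + 1 = t₀ + 2 by omega] at hf1
  have key : ∀ t, t₀ + 2 ≤ t → t + a (t₀ + 2) ≤ t₀ + 2 + N →
      a t + (t₀ + 2) = a (t₀ + 2) + t ∧ b t = b t₀ ∧ (a t < A t ∨ a t = N) := by
    intro t ht
    induction t, ht using Nat.le_induction with
    | base => intro _; omega
    | succ t ht ih =>
      intro h2
      have h3 := ih (by omega)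
      have h4 := h t
      have h5 := hfeed t (by omega) (by omega)
      have h6 := hA (t + 1) (by omega) (by omega)
      have h7 := hA t (by omega) (by omega)
      omega
  -- The feed is only known to be steady after `t₀`, so a pause is possible in the first two steps.
  -- From `t₀ + 2` on the server is busy, and `f` is the time at which it has served all `N`
  -- packets.
  refine ⟨t₀ + 2 + N - a (t₀ + 2), by omega, by omega, ?_, ?_, ?_⟩
  · intro t h1 h2
    have h3 := key t h1 (by omega)
    have h4 := key (t + 1) (by omega) (by omega)
    omega
  · intro t h1 h2
    rcases (by omega : t = t₀ ∨ t = t₀ + 1 ∨ t₀ + 2 ≤ t) with rfl | rfl | h3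
    · rfl
    · omega
    · exact (key t h3 (by omega)).2.1
  · intro t ht
    induction t, ht using Nat.le_induction with
    | base =>
      intro h2
      have h3 := key (t₀ + 2 + N - a (t₀ + 2)) (by omega) (by omega)
      omega
    | succ t ht ih =>
      intro h2
      have h3 := ih (by omega)
      have h4 := h t
      have h5 := hA t (by omega) (by omega)
      have h6 := hB1 t (by omega) (by omega)
      omega

end Prio

/-! ### Single links under nearest-to-go -/

section Ntg

variable {p q s : ℕ} {T : ℕ → ℕ} {lo hi : ℕ → Load → ℕ} {π : Network.Protocol}
  {ar cr : Kind → ℕ → ℕ → ℕ}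

theorem schedule_le_one {t : ℕ} {K : Kind} (hK : K.2 ≠ .V) :
    schedule p q s T lo hi t K ≤ 1 := by
  rw [schedule, if_neg (c := t = 0 ∧ _)]
  · split_ifs <;> simp
  · rintro ⟨_, rfl⟩
    exact hK rfl

namespace IsFlow

theorem ar_eq_zero (F : IsFlow (schedule p q s T lo hi) π ar cr) {L : Load} (hL : L ≠ .V)
    (h : ∀ k, hi k L ≤ lo k L) (b : Bool) (t : ℕ) : ar (b, L) 0 t = 0 := by
  rw [F.ar_zero]
  refine Finset.sum_eq_zero fun u _ => ?_
  rw [schedule, if_neg (c := u = 0 ∧ _) (fun h1 => hL (congrArg Prod.snd h1.2)),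
    add_zero, if_neg]
  rintro ⟨_, k, _, h1, h2⟩
  have := h k
  dsimp only at h1 h2
  omega

theorem chain {num : ℕ → Kind → ℕ} (F : IsFlow num π ar cr) (K : Kind) (i t : ℕ)
    (h : i + 1 < (route K).length) : cr K (i + 1) t ≤ cr K i t := by
  have := F.cr_le K (i + 1) t h
  rwa [F.ar_succ] at this

theorem ar_le_succ {num : ℕ → Kind → ℕ} (F : IsFlow num π ar cr) (K : Kind) (t : ℕ) :
    ar K 0 t ≤ ar K 0 (t + 1) := by
  rw [F.ar_zero_succ]; omega

theorem ar_mono {num : ℕ → Kind → ℕ} (F : IsFlow num π ar cr) (K : Kind) :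
    Monotone (ar K 0) :=
  monotone_nat_of_le_succ (F.ar_le_succ K)

theorem Sl_succ {num : ℕ → Kind → ℕ} (F : IsFlow num π ar cr) (h : Bool)
    (hS : ∀ t, Se cr h t ≤ Se cr h (t + 1) ∧ Se cr h (t + 1) ≤ Se cr h t + 1) (t : ℕ) :
    Sl cr h (t + 1) = Se cr h t :=
  (F.single_l h).delay (by simp [Se, F.cr_zero]) (by simp [Sl, F.cr_zero]) hS t

theorem cr_W_succ {num : ℕ → Kind → ℕ} (F : IsFlow num π ar cr) (h : Bool)
    (hW : ∀ t, cr (h, .W) 0 t ≤ cr (h, .W) 0 (t + 1) ∧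
      cr (h, .W) 0 (t + 1) ≤ cr (h, .W) 0 t + 1) (t : ℕ) :
    cr (h, .W) 1 (t + 1) = cr (h, .W) 0 t ∧ cr (h, .W) 2 (t + 2) = cr (h, .W) 0 t := by
  have h1 := (F.single_k h).delay (F.cr_zero _ _) (F.cr_zero _ _) hW
  have h2 := (F.single_j h).delay (F.cr_zero _ _) (F.cr_zero _ _) (F.single_k h).le_succ
  exact ⟨h1 t, by rw [h2, h1]⟩

variable (F : IsFlow (schedule p q s T lo hi) .ntg ar cr)
include F

/-- The priority stream leaves `e` at most once per step, so it passes `l` and `g` without waiting.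
Link `g` is thus free for `X` in step `t + 2` exactly if `e` did not serve this stream in step `t`.
-/
theorem ntg_g (hZ : ∀ k, hi k .Zg ≤ lo k .Zg) (h : Bool) (t : ℕ) :
    Sg cr h (t + 2) = Se cr h t ∧
    ((Se cr h t < Se cr h (t + 1) ∧ cr (h, .X) 0 (t + 3) = cr (h, .X) 0 (t + 2)) ∨
     (Se cr h t = Se cr h (t + 1) ∧
      ((cr (h, .X) 0 (t + 2) < ar (h, .X) 0 (t + 2) ∧
        cr (h, .X) 0 (t + 3) = cr (h, .X) 0 (t + 2) + 1) ∨
       (cr (h, .X) 0 (t + 2) = ar (h, .X) 0 (t + 2) ∧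
        cr (h, .X) 0 (t + 3) = cr (h, .X) 0 (t + 2))))) := by
  have hZ0 := F.ar_eq_zero (by simp) hZ h
  have hZ1 : ∀ t, cr (h, .Zg) 0 t = 0 := fun t => by
    have h1 := F.cr_le (h, .Zg) 0 t (by simp [route])
    have h2 := hZ0 t
    omega
  have hl := F.Sl_succ h (F.prio_e rfl h).single.le_succ
  have hg := F.prio_g rfl h
  have hd := hg.single.delay (by simp [Sl, F.cr_zero, hZ0]) (by simp [Sg, F.cr_zero])
    (fun t => by have := (F.single_l h).le_succ t; simp only [hZ0]; omega)
  have h1 := hd t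
  have h2 := hd (t + 1)
  have h3 := hg (t + 2)
  simp only [hZ0, hZ1, add_zero] at h1 h2 h3
  rw [show t + 1 + 1 = t + 2 by omega] at h2
  rw [hl] at h2
  rw [hl (t + 1)] at h3
  simp only [Nat.add_assoc, Nat.reduceAdd] at h2 h3
  omega

/-- As at `g`, now for the packets `W`, which reach `y` via `k` and `j`: whether `Y` may use `y` in
step `t + 3` is decided by `e` in step `t`. -/
theorem ntg_y (hZ : ∀ k, hi k .Zy ≤ lo k .Zy) (h : Bool) (t : ℕ) :
    cr (h, .W) 3 (t + 3) = cr (h, .W) 0 t ∧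
    ((cr (h, .W) 0 t < cr (h, .W) 0 (t + 1) ∧ cr (h, .Y) 0 (t + 4) = cr (h, .Y) 0 (t + 3)) ∨
     (cr (h, .W) 0 t = cr (h, .W) 0 (t + 1) ∧
      ((cr (h, .Y) 0 (t + 3) < ar (h, .Y) 0 (t + 3) ∧
        cr (h, .Y) 0 (t + 4) = cr (h, .Y) 0 (t + 3) + 1) ∨
       (cr (h, .Y) 0 (t + 3) = ar (h, .Y) 0 (t + 3) ∧
        cr (h, .Y) 0 (t + 4) = cr (h, .Y) 0 (t + 3))))) := by
  have hZ0 := F.ar_eq_zero (by simp) hZ h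
  have hZ1 : ∀ t, cr (h, .Zy) 0 t = 0 := fun t => by
    have h1 := F.cr_le (h, .Zy) 0 t (by simp [route])
    have h2 := hZ0 t
    omega
  have hW := F.cr_W_succ h (F.prio_e rfl h).le_succ
  have hy := F.prio_y rfl h
  have hd := hy.single.delay (by simp [F.cr_zero, hZ0]) (by simp [F.cr_zero])
    (fun t => by have := (F.single_j h).le_succ t; simp only [hZ0]; omega)
  have h1 := hd (t + 2)
  have h3 := hy (t + 3)
  simp only [hZ0, hZ1, add_zero] at h1 h3
  rw [(hW t).2] at h1
  simp only [Nat.add_assoc, Nat.reduceAdd] at h1 h3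
  rw [(hW (t + 1)).2] at h3
  omega

theorem ntg_x (h : Bool) (t : ℕ) :
    (ar (h, .Zx) 0 t < ar (h, .Zx) 0 (t + 1) ∧ cr (h, .X) 1 (t + 2) = cr (h, .X) 1 (t + 1)) ∨
    (ar (h, .Zx) 0 t = ar (h, .Zx) 0 (t + 1) ∧
      ((cr (h, .X) 1 (t + 1) < cr (h, .X) 0 (t + 1) ∧
        cr (h, .X) 1 (t + 2) = cr (h, .X) 1 (t + 1) + 1) ∨
       (cr (h, .X) 1 (t + 1) = cr (h, .X) 0 (t + 1) ∧
        cr (h, .X) 1 (t + 2) = cr (h, .X) 1 (t + 1)))) := by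
  have hx := F.prio_x rfl h
  have hz : ∀ t, ar (h, .Zx) 0 t ≤ ar (h, .Zx) 0 (t + 1) ∧
      ar (h, .Zx) 0 (t + 1) ≤ ar (h, .Zx) 0 t + 1 := fun t => by
    rw [F.ar_zero_succ]
    have := schedule_le_one (p := p) (q := q) (s := s) (T := T) (lo := lo) (hi := hi)
      (t := t + 1) (K := (h, .Zx)) (by simp)
    omega
  have h0 : cr (h, .Zx) 0 (t + 1) = ar (h, .Zx) 0 t := by
    have h1 : ar (h, .Zx) 0 0 ≤ 1 := by
      rw [F.ar_zero, zero_add, Finset.sum_range_one]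
      exact schedule_le_one (by simp)
    have h2 := F.cr_zero (h, .Zx) 0
    induction t with
    | zero => have := hx 0; omega
    | succ t ih => have := hx (t + 1); have := hz t; omega
  have h3 := hx (t + 1)
  have h4 := hz t
  simp only [Nat.add_assoc, Nat.reduceAdd] at h3
  omega

theorem ntg_m (h : Bool) (t : ℕ) : cr (h, .Y) 1 (t + 1) = cr (h, .Y) 0 t :=
  (F.single_m h).delay (F.cr_zero _ _) (F.cr_zero _ _) (F.prio_y rfl h).le_succ t

end IsFlow

end Ntg

/-! ### A phase against nearest-to-go -/

section Ntg

variable {p q s₀ : ℕ} {T : ℕ → ℕ} {lo hi : ℕ → Load → ℕ} {ar cr : Kind → ℕ → ℕ → ℕ}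

/-- The state under nearest-to-go at time `t`, when the half `h` is about to be filled: between
`s` and `s + D` packets have yet to cross its link `e`, and hardly anything else is left. -/
structure NtgInv (ar cr : Kind → ℕ → ℕ → ℕ) (h : Bool) (t s D : ℕ) : Prop where
  crossed : Se cr (!h) t = Stot ar (!h) t
  W : ∀ b, cr (b, .W) 3 t = ar (b, .W) 0 t
  X : cr (!h, .X) 0 t = ar (!h, .X) 0 t
  lower : Se cr h t + s ≤ Stot ar h t
  upper : Stot ar h t ≤ Se cr h t + s + D

/-- The windows of one phase of the injections against nearest-to-go. -/
structure NtgWindows (p q s w D jW jX jY : ℕ) (lo hi : Load → ℕ) : Prop where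
  hw : w = p * jW
  loW : lo .W = 2
  hiW : hi .W = 2 + q * jW
  loX : lo .X = 4
  hiX : hi .X = 4 + q * jX
  loZx : lo .Zx = s
  hiZx : hi .Zx = s + w
  loY : lo .Y = s + D + 5
  hiY : hi .Y = s + D + 5 + q * jY
  V : hi .V ≤ lo .V
  W_le : 2 + q * jW ≤ s
  X_le : 4 + q * jX ≤ s
  Y_le : D + 5 + q * jY ≤ w
  Xw : p * jX ≤ w

/-- Counts decrease along a route, so equality of the sums at its two ends forces equality
everywhere in between. -/
theorem IsFlow.X_all_crossed {num : ℕ → Kind → ℕ} {π : Network.Protocol}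
    (F : IsFlow num π ar cr) {h : Bool} {t : ℕ} (hS : Se cr (!h) t = Stot ar (!h) t) :
    cr (h, .X) 0 t = ar (h, .X) 0 t ∧ cr (h, .X) 1 t = ar (h, .X) 0 t ∧
    cr (h, .Y) 0 t = ar (h, .Y) 0 t ∧ cr (h, .Y) 1 t = ar (h, .Y) 0 t ∧
    cr (h, .V) 0 t = ar (h, .V) 0 t := by
  simp only [Se, Stot, Bool.not_not] at hS
  have h1 := F.chain (h, .X) 1 t (by simp [route])
  have h2 := F.chain (h, .X) 0 t (by simp [route])
  have h3 := F.cr_le (h, .X) 0 t (by simp [route])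
  have h4 := F.chain (h, .Y) 1 t (by simp [route])
  have h5 := F.chain (h, .Y) 0 t (by simp [route])
  have h6 := F.cr_le (h, .Y) 0 t (by simp [route])
  have h7 := F.cr_le (h, .V) 0 t (by simp [route])
  simp only [zero_add, Nat.reduceAdd] at h1 h2 h4 h5
  omega

theorem IsFlow.W_all_crossed {num : ℕ → Kind → ℕ} {π : Network.Protocol}
    (F : IsFlow num π ar cr) {h : Bool} {t : ℕ} (hW : cr (h, .W) 3 t = ar (h, .W) 0 t) :
    cr (h, .W) 0 t = ar (h, .W) 0 t ∧ cr (h, .W) 1 t = ar (h, .W) 0 t ∧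
    cr (h, .W) 2 t = ar (h, .W) 0 t := by
  have h1 := F.chain (h, .W) 0 t (by simp [route])
  have h2 := F.chain (h, .W) 1 t (by simp [route])
  have h3 := F.chain (h, .W) 2 t (by simp [route])
  have h4 := F.cr_le (h, .W) 0 t (by simp [route])
  simp only [zero_add, Nat.reduceAdd] at h1 h2 h3
  omega

theorem IsFlow.Sa_le_Stot {num : ℕ → Kind → ℕ} {π : Network.Protocol}
    (F : IsFlow num π ar cr) (h : Bool) (t : ℕ) : Sa ar cr h t ≤ Stot ar h t := by
  simp only [Sa, Stot]
  have h2 := F.chain (!h, .X) 0 t (by simp [route])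
  have h3 := F.cr_le (!h, .X) 0 t (by simp [route])
  have h5 := F.chain (!h, .Y) 0 t (by simp [route])
  have h6 := F.cr_le (!h, .Y) 0 t (by simp [route])
  simp only [zero_add] at h2 h5
  omega

theorem IsFlow.Zy_eq_zero {π : Network.Protocol} (F : IsFlow (schedule p q s₀ T lo hi) π ar cr)
    (hZy : ∀ k, hi k .Zy ≤ lo k .Zy) (b : Bool) (t : ℕ) :
    ar (b, .Zy) 0 t = 0 ∧ cr (b, .Zy) 0 t = 0 := by
  have h1 := F.ar_eq_zero (by simp) hZy b t
  have h2 := F.cr_le (b, .Zy) 0 t (by simp [route])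
  omega

theorem IsFlow.cr_W_three_of_le (F : IsFlow (schedule p q s₀ T lo hi) .ntg ar cr)
    (hZy : ∀ k, hi k .Zy ≤ lo k .Zy) {b : Bool} {t₀ t : ℕ}
    (hW : cr (b, .W) 3 t₀ = ar (b, .W) 0 t₀) (ht : t₀ ≤ t)
    (hI : ar (b, .W) 0 t = ar (b, .W) 0 t₀) : cr (b, .W) 3 t = ar (b, .W) 0 t₀ := by
  have h1 : ∀ t, cr (b, .W) 3 t ≤ cr (b, .W) 3 (t + 1) := fun t => by
    have h2 := (F.prio_y rfl b).single.le_succ t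
    simp only [(F.Zy_eq_zero hZy b _).2, add_zero] at h2
    exact h2.1
  have h3 := monotone_nat_of_le_succ h1 ht
  have h4 := F.chain (b, .W) 2 t (by simp [route])
  have h5 := F.chain (b, .W) 1 t (by simp [route])
  have h6 := F.chain (b, .W) 0 t (by simp [route])
  have h7 := F.cr_le (b, .W) 0 t (by simp [route])
  simp only [zero_add, Nat.reduceAdd] at h4 h5 h6
  omega

section Links

variable (F : IsFlow (schedule p q s₀ T lo hi) .ntg ar cr)
include F

/-- The packets `X` are blocked at `g` until all the packets that cross `h` have left. -/
theorem ntg_X_at_g (hZg : ∀ k, hi k .Zg ≤ lo k .Zg) {h : Bool} {t₀ t₁ f N n : ℕ}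
    (hX0 : cr (h, .X) 0 t₀ = ar (h, .X) 0 t₀) (hf : t₀ + 2 ≤ f)
    (hI0 : ∀ t, t₀ ≤ t → t < t₀ + 4 → ar (h, .X) 0 t = ar (h, .X) 0 t₀)
    (hI1 : ∀ t, f + 2 ≤ t → t ≤ t₁ → ar (h, .X) 0 t = ar (h, .X) 0 t₀ + n)
    (hSe : ∀ t, t₀ + 2 ≤ t → t < f → Se cr h (t + 1) = Se cr h t + 1)
    (hSe2 : ∀ t, f ≤ t → t ≤ t₁ → Se cr h t = N) :
    (∀ t, t₀ ≤ t → t ≤ f + 2 → cr (h, .X) 0 t = ar (h, .X) 0 t₀) ∧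
    (∀ t, f + 2 ≤ t → t ≤ t₁ →
      cr (h, .X) 0 t = ar (h, .X) 0 t₀ + min n (t - (f + 2))) := by
  have h1 : ∀ t, t₀ ≤ t → t ≤ f + 2 → cr (h, .X) 0 t = ar (h, .X) 0 t₀ := by
    intro t ht
    induction t, ht using Nat.le_induction with
    | base => intro _; exact hX0
    | succ t ht ih =>
      intro h'
      have h2 := ih (by omega)
      by_cases h3 : t < t₀ + 4
      · have h4 := hI0 t ht h3
        have h5 := F.prio_g rfl h t
        omega
      · obtain ⟨u, rfl⟩ : ∃ u, t = u + 2 := ⟨t - 2, by omega⟩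
        have h4 := (F.ntg_g hZg h u).2
        have h5 := hSe u (by omega) (by omega)
        rw [h2] at h4
        simp only [Nat.add_assoc, Nat.reduceAdd] at h4 ⊢
        omega
  refine ⟨h1, fun t ht => ?_⟩
  induction t, ht using Nat.le_induction with
  | base => intro _; rw [h1 _ (by omega) le_rfl]; simp
  | succ t ht ih =>
    intro h'
    have h2 := ih (by omega)
    obtain ⟨u, rfl⟩ : ∃ u, t = u + 2 := ⟨t - 2, by omega⟩
    have h4 := (F.ntg_g hZg h u).2
    rw [hI1 (u + 2) ht (by omega), hSe2 u (by omega) (by omega),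
      hSe2 (u + 1) (by omega) (by omega)] at h4
    simp only [Nat.add_assoc, Nat.reduceAdd] at h4 ⊢
    omega

/-- While packets `Zx` are injected, the packets `X` leave the link `x` only in the slots that
these leave free; afterwards they leave it without a pause. -/
theorem ntg_X_at_x {h : Bool} {t₀ f u m t₁ n c z : ℕ} (hf : t₀ ≤ f) (hm : f + 3 ≤ m)
    (huf : u ≤ f)
    (hX0 : cr (h, .X) 1 t₀ = c)
    (hg1 : ∀ t, t₀ ≤ t → t ≤ f + 2 → cr (h, .X) 0 t = c)
    (hg2 : ∀ t, f + 2 ≤ t → t ≤ t₁ → cr (h, .X) 0 t = c + min n (t - (f + 2)))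
    (hz : ∀ t, f ≤ t → t ≤ t₁ → ar (h, .Zx) 0 t = z + slots p q u (min (t + 1) m))
    (hslots : ∀ t, f + 3 ≤ t → t ≤ m →
      t - (f + 3) + (t₁ - m) + 1 ≤ n + slots p q (f + 3) t) (hmt : m ≤ t₁) :
    (∀ t, f + 3 ≤ t → t ≤ m → cr (h, .X) 1 t + slots p q (f + 3) t = c + (t - (f + 3))) ∧
    (∀ t, m ≤ t → t ≤ t₁ → cr (h, .X) 1 t = cr (h, .X) 1 m + (t - m)) := by
  have h1 : ∀ t, t₀ ≤ t → t ≤ f + 3 → cr (h, .X) 1 t = c := by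
    intro t ht
    induction t, ht using Nat.le_induction with
    | base => intro _; exact hX0
    | succ t ht ih =>
      intro h'
      have h2 := ih (by omega)
      have h3 := F.prio_x rfl h t
      have h4 := hg1 t (by omega) (by omega)
      omega
  have h2 : ∀ t, f + 3 ≤ t → t ≤ m →
      cr (h, .X) 1 t + slots p q (f + 3) t = c + (t - (f + 3)) := by
    intro t ht
    induction t, ht using Nat.le_induction with
    | base => intro _; rw [h1 _ (by omega) le_rfl, slots_self]; simp
    | succ t ht ih =>
      intro h'
      have h2 := ih (by omega)
      -- This keeps the queue of `X` at `x` from running dry: fewer than `n` packets `X` have left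
      -- so far, so every slot without a `Zx` serves one of them.
      have h5 := hslots (t + 1) (by omega) h'
      obtain ⟨v, rfl⟩ : ∃ v, t = v + 1 := ⟨t - 1, by omega⟩
      have h3 := F.ntg_x h v
      have h4 := hg2 (v + 1) (by omega) (by omega)
      rw [hz v (by omega) (by omega), hz (v + 1) (by omega) (by omega),
        min_eq_left (show v + 1 + 1 ≤ m by omega), min_eq_left (show v + 1 ≤ m by omega),
        slots_succ (show u ≤ v + 1 by omega), h4] at h3
      rw [slots_succ (show f + 3 ≤ v + 1 by omega)] at h5 ⊢
      generalize slots p q u (v + 1) = a at *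
      generalize slots p q (f + 3) (v + 1) = b at *
      simp only [Nat.add_assoc, Nat.reduceAdd] at h3 ⊢
      split_ifs at * <;> omega
  refine ⟨h2, fun t ht => ?_⟩
  induction t, ht using Nat.le_induction with
  | base => intro _; simp
  | succ t ht ih =>
    intro h'
    have h3 := ih (by omega)
    have h4 := h2 m hm le_rfl
    have h5 := hslots m hm le_rfl
    obtain ⟨v, rfl⟩ : ∃ v, t = v + 1 := ⟨t - 1, by omega⟩
    have h6 := F.ntg_x h v
    have h7 := hg2 (v + 1) (by omega) (by omega)
    rw [hz v (by omega) (by omega), hz (v + 1) (by omega) (by omega),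
      min_eq_right (show m ≤ v + 1 + 1 by omega), min_eq_right (show m ≤ v + 1 by omega),
      h7] at h6
    simp only [Nat.add_assoc, Nat.reduceAdd] at h6 ⊢
    omega

/-- The packets `Y` are blocked at `y` as long as packets `W` arrive there. -/
theorem ntg_Y_at_y (hZy : ∀ k, hi k .Zy ≤ lo k .Zy) {h : Bool} {t₀ m f c : ℕ} (hf : t₀ ≤ f)
    (h0 : cr (h, .Y) 0 t₀ = c) (h1 : cr (h, .Y) 1 t₀ = c)
    (hI : ∀ t, t₀ ≤ t → t < f + 3 → ar (h, .Y) 0 t = c)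
    (hW : ∀ t, f ≤ t → t + 3 < m → cr (h, .W) 0 t < cr (h, .W) 0 (t + 1)) :
    ∀ t, t₀ ≤ t → t ≤ m → cr (h, .Y) 1 t = c := by
  have h2 : ∀ t, t₀ ≤ t → t ≤ m → cr (h, .Y) 0 t = c := by
    intro t ht
    induction t, ht using Nat.le_induction with
    | base => intro _; exact h0
    | succ t ht ih =>
      intro h'
      have h2 := ih (by omega)
      by_cases h3 : t < f + 3
      · have h4 := hI t ht h3
        have h5 := F.prio_y rfl h t
        omega
      · obtain ⟨u, rfl⟩ : ∃ u, t = u + 3 := ⟨t - 3, by omega⟩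
        have h4 := (F.ntg_y hZy h u).2
        have h5 := hW u (by omega) (by omega)
        simp only [Nat.add_assoc, Nat.reduceAdd] at h4 ⊢
        omega
  intro t ht h'
  rcases (by omega : t = t₀ ∨ t₀ < t) with rfl | h3
  · exact h1
  · obtain ⟨u, rfl⟩ : ∃ u, t = u + 1 := ⟨t - 1, by omega⟩
    rw [F.ntg_m, h2 u (by omega) (by omega)]

/-- A link `e` at which packets arrive one by one. -/
theorem ntg_trickle {h : Bool} {t₀ m t₁ : ℕ} (hm : t₀ ≤ m)
    (h0 : Se cr h t₀ = Sa ar cr h t₀)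
    (h1 : ∀ t, t₀ ≤ t → t < m → Sa ar cr h (t + 1) ≤ Sa ar cr h t + 1)
    (h2 : ∀ t, m ≤ t → t ≤ t₁ → Sa ar cr h m + (t - m) ≤ Sa ar cr h t) (hmt : m ≤ t₁) :
    Sa ar cr h m + (t₁ - m) ≤ Se cr h t₁ + 1 ∧ Se cr h t₁ ≤ Sa ar cr h m + (t₁ - m) := by
  have h3 : ∀ t, t₀ ≤ t → t ≤ m →
      Se cr h t ≤ Sa ar cr h t ∧ Sa ar cr h t ≤ Se cr h t + 1 := by
    intro t ht
    induction t, ht using Nat.le_induction with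
    | base => intro _; omega
    | succ t ht ih =>
      intro h'
      have h3 := ih (by omega)
      have h4 := F.prio_e rfl h t
      have h5 := h1 t ht (by omega)
      have h6 : Sa ar cr h t ≤ Sa ar cr h (t + 1) := by
        have h7 := (F.prio_x rfl (!h)).le_succ t
        have h8 := (F.single_m (!h)).le_succ t
        have h9 := F.ar_le_succ (!h, .V) t
        simp only [Sa]
        omega
      omega
  have h4 : ∀ t, m ≤ t → t ≤ t₁ → Sa ar cr h m + (t - m) ≤ Se cr h t + 1 ∧
      Se cr h t ≤ Sa ar cr h m + (t - m) := by
    intro t ht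
    induction t, ht using Nat.le_induction with
    | base => intro _; have := h3 m hm le_rfl; omega
    | succ t ht ih =>
      intro h'
      have h5 := ih (by omega)
      have h6 := F.prio_e rfl h t
      have h7 := h2 t ht (by omega)
      omega
  exact h4 t₁ hmt le_rfl

end Links

variable (S : IsSchedule T lo hi) (F : IsFlow (schedule p q s₀ T lo hi) .ntg ar cr)
include S F

/-- The link `e` of the half to which the packets head is kept busy. -/
theorem ntg_feed (hZy : ∀ k, hi k .Zy ≤ lo k .Zy) {k t₀ t₁ : ℕ} (h₀ : T k = t₀)
    (h₁ : T (k + 1) = t₁) (hW : cr (!k.bodd, .W) 3 t₀ = ar (!k.bodd, .W) 0 t₀)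
    (hX : cr (!k.bodd, .X) 0 t₀ = ar (!k.bodd, .X) 0 t₀) {t : ℕ} (ht : t₀ < t) (ht' : t < t₁) :
    Sa ar cr k.bodd t < Sa ar cr k.bodd (t + 1) ∨
      Sa ar cr k.bodd (t + 1) = Stot ar k.bodd t₀ := by
  obtain ⟨u, rfl⟩ : ∃ u, t = u + 1 := ⟨t - 1, by omega⟩
  have hI : ∀ L t, t₀ ≤ t → t ≤ t₁ → ar (!k.bodd, L) 0 t = ar (!k.bodd, L) 0 t₀ :=
    fun L t h h' => by
      have := F.idle_half S k L (t := t) (by omega) (by omega)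
      rwa [h₀] at this
  simp only [Sa, Stot]
  generalize (!k.bodd) = b at *
  have hV := hI .V
  have hx := F.ntg_x b u
  rw [hI .Zx u (by omega) (by omega), hI .Zx (u + 1) (by omega) (by omega)] at hx
  have hXmono := (F.prio_g rfl b).mono (show t₀ ≤ u + 1 by omega)
  have hXle := F.cr_le (b, .X) 0 (u + 1) (by simp [route])
  rw [hI .X _ (by omega) (by omega)] at hXle
  have hY1 := F.ntg_m b u
  have hY2 := F.ntg_m b (u + 1)
  have hYle := F.cr_le (b, .Y) 0 (u + 1) (by simp [route])
  rw [hI .Y _ (by omega) (by omega)] at hYle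
  have hW' := F.cr_W_three_of_le hZy hW (show t₀ ≤ u by omega) (hI .W u (by omega) (by omega))
  have hW2 := (F.W_all_crossed (hW'.trans (hI .W u (by omega) (by omega)).symm)).2.2
  rw [hI .W u (by omega) (by omega)] at hW2
  have hy := F.prio_y rfl b u
  have hZ := F.Zy_eq_zero hZy b u
  have hV1 := hI .V (u + 1) (by omega) (by omega)
  have hV2 := hI .V (u + 2) (by omega) (by omega)
  have hIY := hI .Y u (by omega) (by omega)
  simp only [hZ, hW', hW2, hIY] at hy
  simp only [Nat.add_assoc, Nat.reduceAdd] at *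
  omega

-- The interval of length `L` starting at `u` is the time during which `X` competes with `Zx`; then
-- `L` minus its slots packets leak to the other half, where they cross `e` almost at once. In the
-- final `D + 5` steps that link serves one packet per step, up to one. The rest of the injected `X`
-- and `Y` is the new backlog.
set_option maxHeartbeats 1000000 in
theorem ntg_phase (hp : p ≤ q) (hZg : ∀ k, hi k .Zg ≤ lo k .Zg) (hZy : ∀ k, hi k .Zy ≤ lo k .Zy)
    {k t₀ s w D jW jX jY : ℕ} (h₀ : T k = t₀) (h₁ : T (k + 1) = t₀ + s + w + D + 5)
    (C : NtgWindows p q s w D jW jX jY (lo k) (hi k))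
    (hslots : ∀ u L, L ≤ w → L + D + 6 ≤ p * jX + slots p q u (u + L))
    (I : NtgInv ar cr k.bodd t₀ s D) :
    ∃ u L, L ≤ w ∧ w ≤ L + D + 5 ∧ ∀ s' D',
      s' + L + D + 5 ≤ p * jX + p * jY + slots p q u (u + L) →
      p * jX + p * jY + slots p q u (u + L) + 1 ≤ s' + D' + L + D + 5 →
      NtgInv ar cr (k + 1).bodd (t₀ + s + w + D + 5) s' D' := by
  obtain ⟨hw, loW, hiW, loX, hiX, loZx, hiZx, loY, hiY, hV, W_le, X_le, Y_le, Xw⟩ := C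
  have hIdle : ∀ L t, t₀ ≤ t → t ≤ t₀ + s + w + D + 5 →
      ar (!k.bodd, L) 0 t = ar (!k.bodd, L) 0 t₀ := fun L t h h' => by
    have := F.idle_half S k L (t := t) (by omega) (by omega)
    rwa [h₀] at this
  have hPW := F.pulse S k .W
  have hPX := F.pulse S k .X
  have hPY := F.pulse S k .Y
  have hPZ := F.pulse S k .Zx
  have hPV := F.pulse S k .V
  rw [h₀, h₁, loW, hiW, show t₀ + (2 + q * jW) = t₀ + 2 + q * jW by omega] at hPW
  rw [h₀, h₁, loX, hiX, show t₀ + (4 + q * jX) = t₀ + 4 + q * jX by omega] at hPX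
  rw [h₀, h₁, loY, hiY, show t₀ + (s + D + 5) = t₀ + s + D + 5 by omega,
    show t₀ + (s + D + 5 + q * jY) = t₀ + s + D + 5 + q * jY by omega] at hPY
  rw [h₀, h₁, loZx, hiZx, show t₀ + (s + w) = t₀ + s + w by omega] at hPZ
  rw [h₀, h₁] at hPV
  have hStot : ∀ t, t₀ ≤ t → t ≤ t₀ + s + w + D + 5 → Stot ar k.bodd t = Stot ar k.bodd t₀ :=
    fun t h h' => by simp only [Stot, hIdle _ t h h']
  have hWb : (k + 1).bodd = !k.bodd := by simp
  have hX0 := F.X_all_crossed I.crossed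
  have hW0 := F.W_all_crossed (I.W k.bodd)
  -- At `e` of the active half the old packets form the priority class and `W` the other; `f` is
  -- when the old packets are gone and `W` starts to flow.
  obtain ⟨f, hf1, hf2, hSe, hWe1, hWe2⟩ := (F.prio_e rfl k.bodd).drain (t₀ := t₀)
    (t₁ := t₀ + s + w + D + 5) (N := Stot ar k.bodd t₀) (w := w)
    (by have := I.upper; omega)
    (fun t h h' => by rw [← hStot t h h']; exact F.Sa_le_Stot _ _)
    (fun t h h' => ntg_feed S F hZy h₀ h₁ (I.W _) I.X h h')
    (fun t h h' => by rw [hPW.before h (by omega) (by omega)]; exact hW0.1.symm)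
    (fun t h h' => by
      have := I.lower
      rw [hPW.after hp (by omega) h' (by omega), ← hw, hW0.1])
    (by have := I.lower; omega)
  have hlow := I.lower
  have hup := I.upper
  have hfs : t₀ + s ≤ f := by omega
  have hfD : f ≤ t₀ + s + D + 2 := by omega
  have hSe2 : ∀ t, f ≤ t → t ≤ t₀ + s + w + D + 5 → Se cr k.bodd t = Stot ar k.bodd t₀ :=
    fun t h h' => (hWe2 t h h').1
  clear hf1 hf2
  clear hW0
  -- Gaps at `e` can occur only in its first two steps and have passed `g` two steps later, which is
  -- why `X` starts at offset 4.
  obtain ⟨hXg1, hXg2⟩ := ntg_X_at_g F hZg (h := k.bodd) (n := p * jX) hX0.1 (by omega)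
    (fun t h h' => hPX.before h (by omega) (by omega))
    (fun t h h' => hPX.after hp (by omega) h' (by omega)) hSe hSe2
  obtain ⟨hXx1, hXx2⟩ := ntg_X_at_x F (h := k.bodd) (u := t₀ + s) (m := t₀ + s + w)
    (by omega) (by omega) hfs hX0.2.1 hXg1 hXg2 (fun t h h' => hPZ t (by omega) h')
    (fun t h h' => by
      have := hslots (f + 3) (t - (f + 3)) (by omega)
      rw [show f + 3 + (t - (f + 3)) = t by omega] at this
      omega) (by omega)
  have hYm := ntg_Y_at_y F hZy (h := k.bodd) (m := t₀ + s + w) (show t₀ ≤ f by omega)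
    hX0.2.2.1 hX0.2.2.2.1 (fun t h h' => hPY.before h (by omega) (by omega))
    (fun t h h' => by
      have h5 := (hWe2 t (by omega) (by omega)).2
      have h6 := (hWe2 (t + 1) (by omega) (by omega)).2
      omega)
  have hV0 : ∀ t, t₀ ≤ t → t ≤ t₀ + s + w + D + 5 →
      ar (k.bodd, .V) 0 t = ar (k.bodd, .V) 0 t₀ := fun t h h' => by
    rw [hPV t h h', slots_of_le (by omega), add_zero]
  have hSa : ∀ t, Sa ar cr (!k.bodd) t =
      cr (k.bodd, .X) 1 t + cr (k.bodd, .Y) 1 t + ar (k.bodd, .V) 0 t := by simp [Sa]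
  have hend := ntg_trickle F (h := !k.bodd) (t₀ := t₀) (m := t₀ + s + w)
    (t₁ := t₀ + s + w + D + 5) (by omega)
    (by
      rw [hSa, I.crossed]
      simp only [Stot, Bool.not_not]
      omega)
    (fun t h h' => by
      have h4 := (F.prio_x rfl k.bodd).le_succ t
      have h5 := hYm t (by omega) (by omega)
      have h6 := hYm (t + 1) (by omega) (by omega)
      have h7 := hV0 t (by omega) (by omega)
      have h8 := hV0 (t + 1) (by omega) (by omega)
      have h9 := hSa t
      have h10 := hSa (t + 1)
      omega)
    (fun t h h' => by
      have h4 := hXx2 t h h'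
      have h5 := (F.single_m k.bodd).mono h
      have h7 := hV0 t (by omega) (by omega)
      have h8 := hV0 (t₀ + s + w) (by omega) (by omega)
      have h9 := hSa t
      have h10 := hSa (t₀ + s + w)
      omega) (by omega)
  have hmid := hXx1 (t₀ + s + w) (by omega) le_rfl
  have h1 := hSa (t₀ + s + w)
  have h2 := hYm (t₀ + s + w) (by omega) le_rfl
  have h3 := hV0 (t₀ + s + w) (by omega) (by omega)
  have h4 : Stot ar (!k.bodd) (t₀ + s + w + D + 5) = ar (k.bodd, .X) 0 (t₀ + s + w + D + 5) +
      ar (k.bodd, .Y) 0 (t₀ + s + w + D + 5) + ar (k.bodd, .V) 0 (t₀ + s + w + D + 5) := by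
    simp [Stot]
  have h5 := hPX.after hp (t := t₀ + s + w + D + 5) (by omega) le_rfl (by omega)
  have h6 := hPY.after hp (t := t₀ + s + w + D + 5) (by omega) le_rfl (by omega)
  have h7 := hV0 (t₀ + s + w + D + 5) (by omega) le_rfl
  -- Packets `X` leave `g` from time `f + 2` on and can use `x` one step later.
  refine ⟨f + 3, t₀ + s + w - (f + 3), by omega, by omega, ?_⟩
  rw [show f + 3 + (t₀ + s + w - (f + 3)) = t₀ + s + w by omega]
  intro s' D' hs1 hs2
  rw [hWb]
  refine ⟨?_, ?_, ?_, by omega, by omega⟩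
  · rw [Bool.not_not, hSe2 _ (by omega) le_rfl, hStot _ (by omega) le_rfl]
  · clear h1 h2 h3 h4 h5 h6 h7
    intro b
    rcases (by cases b <;> cases k.bodd <;> simp : b = k.bodd ∨ b = !k.bodd) with rfl | rfl
    · have h5 := (F.ntg_y hZy k.bodd (t₀ + s + w + D + 2)).1
      rw [show t₀ + s + w + D + 2 + 3 = t₀ + s + w + D + 5 by omega] at h5
      rw [h5, (hWe2 _ (by omega) (by omega)).2, hPW.after hp (by omega) le_rfl (by omega),
        min_eq_left (by omega), (F.W_all_crossed (I.W k.bodd)).1, hw]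
    · rw [F.cr_W_three_of_le hZy (I.W _) (by omega) (hIdle _ _ (by omega) le_rfl)]
      exact (hIdle _ _ (by omega) le_rfl).symm
  · rw [Bool.not_not, hXg2 _ (by omega) le_rfl, hPX.after hp (by omega) le_rfl (by omega)]
    omega

end Ntg

/-! ### Choice of the windows against nearest-to-go -/

/-- Only these eight pairs of loads need disjoint windows. -/
theorem shared_link_pairs : ∀ L L' : Load, L ≠ L' →
    (∃ (h : Bool) (f : Bool × Arc), f ∈ route (h, L) ∧ f ∈ route (h, L')) →
    (L, L') ∈ ([(.W, .Y), (.W, .Zy), (.Y, .Zy), (.X, .Y), (.X, .V), (.Y, .V), (.X, .Zx),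
      (.X, .Zg)] : List (Load × Load)) ∨
    (L', L) ∈ ([(.W, .Y), (.W, .Zy), (.Y, .Zy), (.X, .Y), (.X, .V), (.Y, .V), (.X, .Zx),
      (.X, .Zg)] : List (Load × Load)) := by
  decide

theorem windows_disjoint {lo hi : Load → ℕ}
    (h : ∀ x ∈ ([(.W, .Y), (.W, .Zy), (.Y, .Zy), (.X, .Y), (.X, .V), (.Y, .V), (.X, .Zx),
      (.X, .Zg)] : List (Load × Load)), hi x.1 ≤ lo x.2 ∨ hi x.2 ≤ lo x.1) (L L' : Load)
    (hne : L ≠ L')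
    (hs : ∃ (h : Bool) (f : Bool × Arc), f ∈ route (h, L) ∧ f ∈ route (h, L')) :
    hi L ≤ lo L' ∨ hi L' ≤ lo L := by
  rcases shared_link_pairs L L' hne hs with h1 | h1
  · exact h _ h1
  · exact (h _ h1).symm

/-- The start of phase `k`, when the phases have lengths `len`. -/
def phaseStart (len : ℕ → ℕ) (k : ℕ) : ℕ := ∑ i ∈ Finset.range k, len i

theorem phaseStart_succ (len : ℕ → ℕ) (k : ℕ) :
    phaseStart len (k + 1) = phaseStart len k + len k :=
  Finset.sum_range_succ _ _

theorem isSchedule_phaseStart {len : ℕ → ℕ} {lo hi : ℕ → Load → ℕ} (h0 : ∀ k L, 0 < lo k L)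
    (h1 : ∀ k L, hi k L ≤ len k)
    (h : ∀ k, ∀ x ∈ ([(.W, .Y), (.W, .Zy), (.Y, .Zy), (.X, .Y), (.X, .V), (.Y, .V), (.X, .Zx),
      (.X, .Zg)] : List (Load × Load)), hi k x.1 ≤ lo k x.2 ∨ hi k x.2 ≤ lo k x.1) :
    IsSchedule (phaseStart len) lo hi where
  mono := monotone_nat_of_le_succ fun k => by rw [phaseStart_succ]; omega
  lo_pos := h0
  hi_le k L := by rw [phaseStart_succ]; have := h1 k L; omega
  disjoint k := windows_disjoint (h k)

def ntgLo (s D : ℕ) : Load → ℕ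
  | .W => 2 | .X => 4 | .Zx => s | .Y => s + D + 5 | _ => 1

def ntgHi (q s w D jW jX jY : ℕ) : Load → ℕ
  | .W => 2 + q * jW | .X => 4 + q * jX | .Zx => s + w | .Y => s + D + 5 + q * jY | _ => 1

/-- The arithmetic of a phase against nearest-to-go, at a rate `p / q > 1 / √2`. -/
theorem ntg_arith {p q n : ℕ} (hp : 0 < p) (hpq : p < q) (hq : q * q < 2 * (p * p))
    (hn : 9 * q + 1 + q * q + (1 + 9 * q + p * (9 * q)) + 3 * (p * (9 * q)) + 4 ≤ n) :
    ∃ s w D jW jX jY, s = p * (q * q) * n ∧ D = p * (9 * q) - 5 ∧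
      NtgWindows p q s w D jW jX jY (ntgLo s D) (ntgHi q s w D jW jX jY) ∧
      (∀ u L, L ≤ w → L + D + 6 ≤ p * jX + slots p q u (u + L)) ∧
      ∀ u L, L ≤ w → w ≤ L + D + 5 →
        p * (q * q) * (n + 1) + L + D + 5 ≤ p * jX + p * jY + slots p q u (u + L) ∧
        p * jX + p * jY + slots p q u (u + L) + 1 ≤ p * (q * q) * (n + 1) + D + L + D + 5 := by
  have hq0 : 0 < q := by omega
  -- The factor 9 is what the final estimate needs. Rounding costs at most `3 * p * q + 6 * q`,
  -- which must not exceed `p * (D + 5)`.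
  obtain ⟨D, hD⟩ : ∃ D, D + 5 = p * (9 * q) := by
    refine ⟨p * (9 * q) - 5, Nat.sub_add_cancel ?_⟩
    have := Nat.mul_le_mul hp (show 9 ≤ 9 * q by omega)
    omega
  -- A backlog of `s = q * (p * q * n)` leaves room for `p * q * n` periods; one is dropped to
  -- accommodate the offset 2, and `D + 5` are dropped for `X`.
  obtain ⟨jW, hjW⟩ : ∃ j, j + 1 = p * q * n :=
    ⟨p * q * n - 1, Nat.sub_add_cancel (Nat.mul_pos (Nat.mul_pos hp hq0) (by omega))⟩
  have hpqn : n ≤ p * q * n := Nat.le_mul_of_pos_left n (Nat.mul_pos hp hq0)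
  obtain ⟨jX, hjX⟩ : ∃ j, j + D + 5 = p * q * n := ⟨p * q * n - (D + 5), by omega⟩
  -- Solved from the target: `p * jX + p * jY` has to be the next backlog plus the leakage, about
  -- `(q - p) * (p * p * n)`, plus the final drain and rounding (see `hsum`).
  obtain ⟨jY, hjY⟩ : ∃ j, j + p * p * n = q * q * (n + 1) + (1 + 9 * q + p * (9 * q)) := by
    refine ⟨_, Nat.sub_add_cancel ?_⟩
    have h1 : p * p * n ≤ q * q * (n + 1) :=
      Nat.mul_le_mul (Nat.mul_le_mul hpq.le hpq.le) (by omega)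
    omega
  have hslots := fun u L => slots_bounds hpq.le hq0 u L
  obtain ⟨a, ha⟩ : ∃ a, a = p * p * n := ⟨_, rfl⟩
  have han : n ≤ a := by rw [ha]; exact Nat.le_mul_of_pos_left n (Nat.mul_pos hp hp)
  have hqa : q * a = p * (p * q * n) := by rw [ha]; ring
  have hwa : p * jW + p = q * a := by rw [hqa, ← hjW]; ring
  have hXa : p * jX + p * (D + 5) = q * a := by rw [hqa, ← hjX]; ring
  have hYa : p * jY + p * a = p * (q * q) * (n + 1) + p + p * (9 * q) + p * (D + 5) := by
    have : p * (jY + p * p * n) = p * jY + p * a := by rw [ha]; ring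
    rw [← this, hjY, hD]; ring
  have hs : p * (q * q) * n = q * (p * q * n) := by ring
  obtain ⟨d, hd⟩ : ∃ d, q = p + d := ⟨q - p, by omega⟩
  have hqd : ∀ x, q * x = p * x + d * x := fun x => by rw [hd, add_mul]
  have hsum : p * jX + p * jY = p * (q * q) * (n + 1) + d * a + p + (D + 5) := by
    have := hqd a
    omega
  refine ⟨p * (q * q) * n, p * jW, D, jW, jX, jY, rfl, by omega, ?_, ?_, ?_⟩
  · refine ⟨rfl, rfl, rfl, rfl, rfl, rfl, rfl, rfl, rfl, le_rfl, ?_, ?_, ?_, ?_⟩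
    · rw [hs, ← hjW, mul_add]; omega
    · have : q * 4 ≤ q * (D + 5) := Nat.mul_le_mul_left q (by omega)
      rw [hs, ← hjX, add_assoc, mul_add]
      omega
    · have h1 : q * jY + q * a = q * (q * q * n) + q * (q * q) +
          q * (1 + 9 * q + p * (9 * q)) := by
        have : q * (jY + p * p * n) = q * jY + q * a := by rw [ha]; ring
        rw [← this, hjY]; ring
      -- The condition ρ > 1/√2 enters here. It lets the window of `Y` fit into the time `w` during
      -- which `W` passes, with a spare `q * n` that absorbs the constants for large `n`.
      have h2 : q * (q * q * n) + q * n ≤ 2 * (q * a) := by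
        rw [ha]
        calc q * (q * q * n) + q * n = q * (q * q + 1) * n := by ring
          _ ≤ q * (2 * (p * p)) * n := by gcongr; omega
          _ = _ := by ring
      have h3 := Nat.mul_le_mul_left q hn
      have h4 : p * (9 * q) ≤ q * (9 * q) := Nat.mul_le_mul_right _ hpq.le
      simp only [mul_add] at h1 h3
      omega
    · exact Nat.mul_le_mul_left p (by omega)
  · intro u L hL
    have h1 := (hslots u L).2
    have h2 : d * L ≤ d * (q * a) := Nat.mul_le_mul_left d (by omega)
    have h4 : d * a + D + 6 + p ≤ p * jX := by
      have h5 : p * (9 * q + 1 + q * q + (1 + 9 * q + p * (9 * q)) + 3 * (p * (9 * q)) + 4)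
        ≤ p * a := Nat.mul_le_mul_left p (hn.trans han)
      have h6 : p * (D + 5) = p * (p * (9 * q)) := by rw [hD]
      have h7 := hqd a
      simp only [mul_add] at h5
      omega
    have h5 := Nat.mul_le_mul_left q h4
    refine Nat.le_of_mul_le_mul_left (c := q) ?_ hq0
    have h6 := hqd L
    have h7 : q * (d * a) = d * (q * a) := by ring
    have h8 : q * p = p * q := by ring
    simp only [mul_add] at h5 ⊢
    omega
  · intro u L hL hL'
    obtain ⟨h1, h2⟩ := hslots u L
    generalize p * (q * q) * (n + 1) = s' at *
    have h6 := hqd L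
    have h7 : q * (d * a) = d * (q * a) := by ring
    have h8 : q * p = p * q := by ring
    have h9 : q * (p * jX + p * jY) = q * (s' + d * a + p + (D + 5)) := by rw [hsum]
    constructor
    · refine Nat.le_of_mul_le_mul_left (c := q) ?_ hq0
      have h3 : d * (L + p) ≤ d * (q * a) := Nat.mul_le_mul_left d (by omega)
      simp only [mul_add] at h3 h9 ⊢
      omega
    · refine Nat.le_of_mul_le_mul_left (c := q) ?_ hq0
      have h3 : d * (q * a) ≤ d * (L + p + (D + 5)) := Nat.mul_le_mul_left d (by omega)
      have h10 := hqd (D + 5)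
      have h11 : p * (D + 5) = 9 * (p * (p * q)) := by rw [hD]; ring
      have h12 : p * q ≤ p * (p * q) := Nat.le_mul_of_pos_left _ hp
      have h13 : q ≤ p * q := Nat.le_mul_of_pos_left _ hp
      have h14 : d * p ≤ q * p := Nat.mul_le_mul_right p (by omega)
      simp only [mul_add] at h3 h9 h10 h11 ⊢
      omega

theorem IsFlow.ntgInv_start {p q s : ℕ} {T : ℕ → ℕ} {lo hi : ℕ → Load → ℕ}
    {ar cr : Kind → ℕ → ℕ → ℕ} {π : Network.Protocol} (S : IsSchedule T lo hi)
    (F : IsFlow (schedule p q s T lo hi) π ar cr) (D : ℕ) : NtgInv ar cr false 0 s D := by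
  have h := F.ar_zero_start S
  refine ⟨?_, ?_, ?_, ?_, ?_⟩ <;> simp [Se, Stot, h, F.cr_zero]

theorem ntg_unstable {r : ℝ} (hr : 1 / Real.sqrt 2 < r) (hr1 : r < 1) :
    ∃ w : ℕ, 0 < w ∧ ∃ σ : forkNet.Injections,
      σ.Admissible w r ∧ forkNet.UnstableForAllRoutes .ntg σ := by
  -- Injecting at a rational rate strictly below `r` leaves the slack that admissibility needs.
  obtain ⟨x, hx1, hx2⟩ := exists_rat_btwn hr
  have hx0 : 0 < x := by
    have : (0 : ℝ) < x := lt_trans (by positivity) hx1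
    exact_mod_cast this
  obtain ⟨p, q, hp, hq, hxpq⟩ : ∃ p q : ℕ, 0 < p ∧ 0 < q ∧ (x : ℝ) = p / q := by
    refine ⟨x.num.toNat, x.den, ?_, x.den_pos, ?_⟩
    · have := Rat.num_pos.2 hx0
      omega
    · rw [Rat.cast_def]
      congr 1
      have : ((x.num.toNat : ℕ) : ℤ) = x.num := Int.toNat_of_nonneg (Rat.num_pos.2 hx0).le
      exact_mod_cast this.symm
  rw [hxpq] at hx1 hx2
  have hq' : (0 : ℝ) < q := by exact_mod_cast hq
  have hp' : (0 : ℝ) < p := by exact_mod_cast hp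
  have hpq : p < q := by
    have : (p : ℝ) < q := by
      have := hx2.trans hr1
      rwa [div_lt_one hq'] at this
    exact_mod_cast this
  have hqq : q * q < 2 * (p * p) := by
    have h2 : (0 : ℝ) < Real.sqrt 2 := by positivity
    rw [div_lt_div_iff₀ h2 hq', one_mul] at hx1
    have h3 : (q : ℝ) * q < (p * Real.sqrt 2) * (p * Real.sqrt 2) :=
      mul_self_lt_mul_self hq'.le hx1
    have h4 : (p * Real.sqrt 2) * (p * Real.sqrt 2) = 2 * (p * p : ℝ) := by
      have := Real.mul_self_sqrt (show (0 : ℝ) ≤ 2 by norm_num)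
      linear_combination (p * p : ℝ) * this
    rw [h4] at h3
    exact_mod_cast h3
  obtain ⟨N, hN⟩ : ∃ N, N = 9 * q + 1 + q * q + (1 + 9 * q + p * (9 * q)) +
    3 * (p * (9 * q)) + 4 := ⟨_, rfl⟩
  choose s w D jW jX jY hs hD hC hslots hend using fun k : ℕ =>
    ntg_arith (n := N + k) hp hpq hqq (by omega)
  obtain ⟨D₀, rfl⟩ : ∃ D₀, D = fun _ => D₀ := ⟨p * (9 * q) - 5, funext hD⟩
  clear hD
  have S : IsSchedule (phaseStart fun k => s k + w k + D₀ + 5) (fun k => ntgLo (s k) D₀)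
      fun k => ntgHi q (s k) (w k) D₀ (jW k) (jX k) (jY k) := by
    refine isSchedule_phaseStart ?_ ?_ ?_
    · intro k L
      have := (hC k).W_le
      cases L <;> simp only [ntgLo] <;> omega
    · intro k L
      have h1 := (hC k).W_le
      have h2 := (hC k).X_le
      have h3 := (hC k).Y_le
      cases L <;> simp only [ntgHi] <;> omega
    · intro k
      have h1 := (hC k).W_le
      have h2 := (hC k).X_le
      have h3 := (hC k).Y_le
      simp only [List.forall_mem_cons, ntgLo, ntgHi, List.not_mem_nil, false_implies,
        implies_true, and_true]
      omega
  obtain ⟨W, hW, hadm⟩ := S.admissible (s := s 0) hpq.le hq hx2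
  refine ⟨W, hW, _, hadm, unstable_of_flow fun ar cr F B => ?_⟩
  have key : ∀ k : ℕ,
      NtgInv ar cr k.bodd (phaseStart (fun k => s k + w k + D₀ + 5) k) (s k) D₀ := by
    intro k
    induction k with
    | zero => exact F.ntgInv_start S D₀
    | succ k ih =>
      have hT := phaseStart_succ (fun k => s k + w k + D₀ + 5) k
      simp only [← add_assoc] at hT
      obtain ⟨u, L, hL, hL', hnext⟩ := ntg_phase S F hpq.le (fun _ => le_rfl) (fun _ => le_rfl)
        rfl hT (hC k) (hslots k) ih
      rw [hT]
      obtain ⟨h1, h2⟩ := hend k u L hL hL'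
      refine hnext _ _ ?_ ?_ <;> rw [hs (k + 1), ← add_assoc N k 1] <;> omega
  refine ⟨_, _, le_trans ?_ (key B).lower⟩
  have h1 : N + B ≤ s B := by
    rw [hs]
    exact Nat.le_mul_of_pos_left _ (Nat.mul_pos hp (Nat.mul_pos hq hq))
  omega

/-! ### First-in-first-out servers -/

namespace Fifo

variable {A a B b : ℕ → ℕ}

theorem mono_left (h : Fifo A a B b) : Monotone a :=
  monotone_nat_of_le_succ fun t => (h.step t).2.2.1

theorem mono_right (h : Fifo A a B b) : Monotone b :=
  monotone_nat_of_le_succ fun t => (h.step t).2.2.2.1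

theorem succ_le (h : Fifo A a B b) (t : ℕ) : a (t + 1) ≤ A t ∧ b (t + 1) ≤ B t := by
  have h1 := h.step t
  have h2 := h.comp t (t + 1)
  omega

theorem le_succ (h : Fifo A a B b) (t : ℕ) : a (t + 1) ≤ a t + 1 ∧ b (t + 1) ≤ b t + 1 := by
  have h1 := h.step t
  omega

/-- Without packets of the second class, the packets of the first class are served alone. -/
theorem alone (h : Fifo A a B b) {t₀ t₁ β : ℕ} (hb : b t₀ = β)
    (hB : ∀ t, t₀ ≤ t → t ≤ t₁ → B t = β) {t : ℕ} (ht : t₀ ≤ t) (ht' : t < t₁) :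
    (a t < A t ∧ a (t + 1) = a t + 1) ∨ (a t = A t ∧ a (t + 1) = a t) := by
  have h1 := h.step t
  have h2 := h.step (t + 1)
  have h3 := hB t ht ht'.le
  have h4 := hB (t + 1) (by omega) ht'
  have h5 := h.mono_right ht
  omega

/-- A server at which the packets arrive one by one has at most one packet to serve. -/
theorem trickle (h : Fifo A a B b) {t₀ t₁ β : ℕ} (hb : b t₀ = β)
    (hB : ∀ t, t₀ ≤ t → t ≤ t₁ → B t = β) (h0 : A t₀ ≤ a t₀ + 1)
    (hA : ∀ t, t₀ ≤ t → t < t₁ → A (t + 1) ≤ A t + 1) {t : ℕ} (ht : t₀ ≤ t) (ht' : t ≤ t₁) :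
    A t ≤ a t + 1 := by
  induction t, ht using Nat.le_induction with
  | base => exact h0
  | succ t ht ih =>
    have h1 := ih (by omega)
    have h2 := h.alone hb hB ht (by omega)
    have h3 := hA t ht (by omega)
    omega

/-- If the cumulative arrivals stay above a line of slope one, then the server never idles while its
service is on that line, so the service does not fall below it. -/
theorem keep_busy (h : Fifo A a B b) {m t₁ β K : ℕ} (hb : b m = β)
    (hB : ∀ t, m ≤ t → t ≤ t₁ → B t = β) (h0 : K ≤ a m)
    (hA : ∀ t, m ≤ t → t < t₁ → K + 1 + (t - m) ≤ A t) {t : ℕ} (ht : m ≤ t) (ht' : t ≤ t₁) :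
    K + (t - m) ≤ a t := by
  induction t, ht using Nat.le_induction with
  | base => omega
  | succ t ht ih =>
    have h1 := ih (by omega)
    have h2 := hA t ht (by omega)
    have h3 := h.alone hb hB ht (by omega)
    omega

/-- A first-in-first-out server that is busy with packets of the first class when packets of the
second class arrive. -/
theorem block (h : Fifo A a B b) {T M t₁ α β n : ℕ} (hTM : T ≤ M)
    (hA : ∀ t, M ≤ t → t ≤ t₁ → A t = α) (hbT : b T = β)
    (hB0 : ∀ t, T ≤ t → t ≤ M → B t = β)
    (hB1 : ∀ t, T + α ≤ t + a T → t ≤ t₁ → B t = β + n)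
    (hbusy : ∀ t, T ≤ t → t < M → a T + (t - T) < A t)
    (hM : M + a T ≤ T + α) (hα : T + α ≤ t₁ + a T) :
    (∀ t, T ≤ t → t + a T ≤ T + α → a t = a T + (t - T) ∧ b t = β) ∧
    (∀ t, T + α ≤ t + a T → t ≤ t₁ → a t = α ∧ b t = β + min n (t + a T - (T + α))) := by
  have h1 : ∀ t, T ≤ t → t + a T ≤ T + α → a t = a T + (t - T) ∧ b t = β := by
    intro t ht
    induction t, ht using Nat.le_induction with
    | base => intro _; omega
    | succ t ht ih =>
      intro h'
      have h2 := ih (by omega)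
      have h3 := h.step t
      -- By time `M` all `α` packets of the first class are there and none of the second, so
      -- first-in-first-out serves all of the former before any of the latter.
      have h4 := h.comp M (t + 1)
      rw [hA M le_rfl (by omega), hB0 M hTM le_rfl] at h4
      by_cases hlt : t < M
      · have h5 := hbusy t ht hlt
        omega
      · have h5 := hA t (by omega) (by omega)
        omega
  refine ⟨h1, fun t ht => ?_⟩
  obtain ⟨τ, hτ⟩ : ∃ τ, τ + a T = T + α := ⟨T + α - a T, by omega⟩
  have hstart := h1 τ (by omega) (by omega)
  have hge : τ ≤ t := by omega
  clear ht
  induction t, hge using Nat.le_induction with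
  | base => intro _; omega
  | succ t ht ih =>
    intro h'
    have h2 := ih (by omega)
    have h3 := h.step t
    have h4 := hA t (by omega) (by omega)
    have h5 := hB1 t (by omega) (by omega)
    have h6 := h.succ_le t
    omega

/-- A stream of packets of the second class that arrive one by one from time `τ` on is mixed with
packets of the first class that arrive at rate `p / q`. -/
theorem merge (h : Fifo A a B b) {p q t₀ t₁ u v τ β n : ℕ} (hp : p ≤ q) (hq : 0 < q)
    (ha0 : a t₀ = A t₀) (hb0 : b t₀ = β) (hA : Pulse A p q t₀ t₁ u v)
    (huτ : u ≤ τ + 1) (hτ : t₀ ≤ τ) (hτv : τ + 1 ≤ v) (hv : v ≤ τ + n + 1)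
    (ht₁ : τ + 1 + n + slots p q u v ≤ t₁)
    (hB0 : ∀ t, t₀ ≤ t → t ≤ τ → B t = β)
    (hB1 : ∀ t, τ ≤ t → t ≤ t₁ → B t = β + min n (t - τ)) :
    (∀ t, τ + 1 + n + slots p q u v ≤ t → t ≤ t₁ → a t = A t ∧ b t = β + n) ∧
    (∀ t y, τ ≤ t → t ≤ t₁ → τ + y + 1 ≤ v → y ≤ n →
      q * (t - τ) + p * q ≤ q * y + p * y → b t ≤ β + y) ∧
    (∀ t y, τ + 1 ≤ t → t ≤ t₁ → q * y + p * y + p * q ≤ q * (t - τ - 1) →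
      β + min n y ≤ b t) := by
  -- the packets of the first class pass one by one until time `τ`
  have h1 : ∀ t, t₀ ≤ t → t ≤ τ → A t ≤ a t + 1 ∧ b t = β := by
    intro t ht
    induction t, ht using Nat.le_induction with
    | base => intro _; omega
    | succ t ht ih =>
      intro h'
      have h2 := ih (by omega)
      have h3 := h.step t
      have h4 := hB0 t ht (by omega)
      have h5 := hA.step_le ht (by omega)
      have h6 := h.succ_le t
      have h7 := h.mono_right (Nat.le_succ t)
      omega
  have hτ1 := h1 τ hτ le_rfl
  have hBτ := hB0 τ hτ le_rfl
  have hAτ : ∀ y, τ + y ≤ t₁ → A (τ + y) = A τ + slots p q (τ + 1) (min (τ + 1 + y) v) := by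
    intro y hy
    have h2 := slots_add (p := p) (q := q) huτ (show τ + 1 ≤ min (τ + 1 + y) v by omega)
    rw [hA (τ + y) (by omega) hy, hA τ hτ (by omega), min_eq_left hτv,
      show τ + y + 1 = τ + 1 + y by omega]
    omega
  have hZ : slots p q (τ + 1) v ≤ slots p q u v := slots_mono huτ le_rfl
  have hAend : ∀ t, τ + n ≤ t → t ≤ t₁ → A t = A τ + slots p q (τ + 1) v := by
    intro t h2 h3
    have h4 := hAτ (t - τ) (by omega)
    rwa [show τ + (t - τ) = t by omega, min_eq_right (by omega)] at h4
  have hAge : ∀ t, τ ≤ t → t ≤ t₁ → A τ ≤ A t := fun t h2 h3 => hA.mono hτ h2 h3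
  -- the server is busy from then on
  have h2 : ∀ t, τ + 1 ≤ t → t ≤ τ + 1 + n + slots p q (τ + 1) v →
      a t + b t = A τ + β + (t - τ - 1) := by
    intro t ht
    induction t, ht using Nat.le_induction with
    | base => intro _; have := h.step τ; omega
    | succ t ht ih =>
      intro h'
      have h3 := ih (by omega)
      have h4 := h.step t
      have h5 := hB1 t (by omega) (by omega)
      by_cases h6 : t < τ + 1 + n
      · have h7 := hAge t (by omega) (by omega)
        omega
      · have h7 := hAend t (by omega) (by omega)
        omega
  have h3 : ∀ t, τ + 1 + n + slots p q (τ + 1) v ≤ t → t ≤ t₁ → a t = A t ∧ b t = β + n := by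
    intro t ht
    induction t, ht using Nat.le_induction with
    | base =>
      intro h'
      have h4 := h2 _ (by omega) le_rfl
      have h5 := h.step (τ + 1 + n + slots p q (τ + 1) v)
      have h6 := hAend _ (by omega) h'
      have h7 := hB1 _ (by omega) h'
      omega
    | succ t ht ih =>
      intro h'
      have h4 := ih (by omega)
      have h5 := h.step t
      have h6 := hAend t (by omega) (by omega)
      have h7 := hAend (t + 1) (by omega) (by omega)
      have h8 := hB1 t (by omega) (by omega)
      omega
  refine ⟨fun t ht ht' => h3 t (by omega) ht', ?_, ?_⟩
  · intro t y h4 h5 h6 h7 h8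
    have h9 : a t + b t ≤ A τ + β + (t - τ) := by
      rcases (by omega : t = τ ∨ τ + 1 ≤ t) with rfl | h9
      · have := h.step t
        omega
      · by_cases h10 : t ≤ τ + 1 + n + slots p q (τ + 1) v
        · have := h2 t h9 h10
          omega
        · have h11 := h3 t (by omega) h5
          have h12 := hAend t (by omega) h5
          omega
    -- Between `τ` and `τ + y` there arrive `y` packets of the second class and the slots of the
    -- first. By `h14` this is at least what has been served since `τ`, so the packets served by `t`
    -- are among those that had arrived by `τ + y`.
    have h10 := h.comp (τ + y) t
    have h11 := hAτ y (by omega)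
    have h12 := hB1 (τ + y) (by omega) (by omega)
    rw [min_eq_left (by omega)] at h11
    have h13 := (slots_bounds hp hq (τ + 1) y).2
    have h14 : t - τ ≤ y + slots p q (τ + 1) (τ + 1 + y) := by
      refine Nat.le_of_mul_le_mul_left (c := q) ?_ hq
      rw [mul_add]
      omega
    omega
  · intro t y h4 h5 h6
    by_cases h7 : t ≤ τ + 1 + n + slots p q (τ + 1) v
    · have h8 := h2 t h4 h7
      have h13 := (slots_bounds hp hq (τ + 1) y).1
      have h14 : y + slots p q (τ + 1) (τ + 1 + y) ≤ t - τ - 1 := by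
        refine Nat.le_of_mul_le_mul_left (c := q) ?_ hq
        rw [mul_add]
        omega
      have h10 := h.comp (τ + y) t
      have h11 := hAτ y (by omega)
      have h12 := hB1 (τ + y) (by omega) (by omega)
      have h15 : slots p q (τ + 1) (min (τ + 1 + y) v) ≤ slots p q (τ + 1) (τ + 1 + y) :=
        slots_mono le_rfl (min_le_left _ _)
      omega
    · have := h3 t (by omega) h5
      omega

end Fifo

/-! ### Blocking at the links under first-in-first-out -/

section Fifo

variable {num : ℕ → Kind → ℕ} {ar cr : Kind → ℕ → ℕ → ℕ}

theorem IsFlow.cr_mono {π : Network.Protocol} (F : IsFlow num π ar cr) (K : Kind) (i : ℕ)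
    (hi : i < (route K).length) : Monotone (cr K i) := by
  refine monotone_nat_of_le_succ fun t => ?_
  rcases F.step t (route K)[i] with h | ⟨K', i', _, _, h2, h3⟩
  · exact (h K i (List.getElem?_eq_getElem hi)).1.ge
  · by_cases he : (K, i) = (K', i')
    · obtain ⟨rfl, rfl⟩ := Prod.mk.inj he
      omega
    · exact ((h3 K i (List.getElem?_eq_getElem hi)).1 he).ge

variable (F : IsFlow num .fifo ar cr)
include F

theorem IsFlow.fifo_Sl_succ (h : Bool) (t : ℕ) : Sl cr h (t + 1) = Se cr h t :=
  F.Sl_succ h (fun t => ⟨(F.fifo_e rfl h).mono_left t.le_succ, ((F.fifo_e rfl h).le_succ t).1⟩) t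

theorem IsFlow.fifo_W_succ (h : Bool) (t : ℕ) : cr (h, .W) 2 (t + 2) = cr (h, .W) 0 t :=
  (F.cr_W_succ h
    (fun t => ⟨(F.fifo_e rfl h).mono_right t.le_succ, ((F.fifo_e rfl h).le_succ t).2⟩) t).2

theorem IsFlow.fifo_m_succ (h : Bool) (t : ℕ) : cr (h, .Y) 1 (t + 1) = cr (h, .Y) 0 t :=
  (F.single_m h).delay (F.cr_zero _ _) (F.cr_zero _ _)
    (fun t => ⟨(F.fifo_y rfl h).mono_right t.le_succ, ((F.fifo_y rfl h).le_succ t).2⟩) t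

/-- The packets that await the link `e` of `h` delay the packets `W`. -/
theorem fifo_W_at_e {h : Bool} {t₀ t₁ R w α β : ℕ} (hR : Se cr h t₀ + R = α)
    (hSa : ∀ t, t₀ ≤ t → t ≤ t₁ → Sa ar cr h t = α) (hW : cr (h, .W) 0 t₀ = β)
    (hW0 : ar (h, .W) 0 t₀ = β)
    (hW1 : ∀ t, t₀ + R ≤ t → t ≤ t₁ → ar (h, .W) 0 t = β + w) (ht₁ : t₀ + R ≤ t₁) :
    (∀ t, t₀ ≤ t → t ≤ t₀ + R → Se cr h t + R = α + (t - t₀) ∧ cr (h, .W) 0 t = β) ∧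
    (∀ t, t₀ + R ≤ t → t ≤ t₁ → Se cr h t = α ∧
      cr (h, .W) 0 t = β + min w (t - (t₀ + R))) := by
  obtain ⟨h1, h2⟩ := (F.fifo_e rfl h).block (T := t₀) (M := t₀) (t₁ := t₁) (α := α) (n := w)
    le_rfl hSa hW (fun t h1 h2 => by rwa [show t = t₀ by omega])
    (fun t h1 h2 => hW1 t (by omega) h2) (fun t h1 h2 => by omega) (by omega) (by omega)
  refine ⟨fun t h3 h4 => ?_, fun t h3 h4 => ?_⟩
  · have := h1 t h3 (by omega)
    omega
  · have := h2 t (by omega) h4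
    rw [show t + Se cr h t₀ - (t₀ + α) = t - (t₀ + R) by omega] at this
    exact this

/-- The packets that cross `h` and the packets `Zg` delay the packets `X`. -/
theorem fifo_X_at_g {h : Bool} {t₀ t₁ s D R z₀ z n α β : ℕ} (hD : 0 < D) (hsR : s ≤ R)
    (hRD : R ≤ s + D) (hDz : D + 10 ≤ z) (ht₁ : t₀ + R + z + 4 ≤ t₁)
    (hSe1 : ∀ t, t₀ ≤ t → t ≤ t₀ + R → Se cr h t + R = α + (t - t₀))
    (hSe2 : ∀ t, t₀ + R ≤ t → t ≤ t₁ → Se cr h t = α) (hgl : Sl cr h t₀ ≤ Sg cr h t₀ + 1)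
    (hZ : cr (h, .Zg) 0 t₀ = z₀) (hZ0 : ar (h, .Zg) 0 t₀ = z₀)
    (hZ1 : ar (h, .Zg) 0 (t₀ + 1) ≤ z₀ + 1)
    (hZ2 : ∀ t, t₀ + s ≤ t → t ≤ t₁ → ar (h, .Zg) 0 t = z₀ + z)
    (hX : cr (h, .X) 0 t₀ = β)
    (hX0 : ∀ t, t₀ ≤ t → t ≤ t₀ + s + D + 1 → ar (h, .X) 0 t = β)
    (hX1 : ∀ t, t₀ + s + z + 1 ≤ t → t ≤ t₁ → ar (h, .X) 0 t = β + n) :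
    ∃ τ, t₀ + R + z + 1 ≤ τ ∧ τ ≤ t₀ + R + z + 4 ∧
      (∀ t, t₀ ≤ t → t ≤ τ → cr (h, .X) 0 t = β) ∧
      (∀ t, τ ≤ t → t ≤ t₁ → Sg cr h t + cr (h, .Zg) 0 t = α + (z₀ + z) ∧
        cr (h, .X) 0 t = β + min n (t - τ)) := by
  have hg := F.fifo_g rfl h
  have hl := F.fifo_Sl_succ h
  have hZm := F.ar_mono (h, .Zg)
  have hXc : ∀ t, t₀ ≤ t → t ≤ t₀ + s + D + 1 → cr (h, .X) 0 t = β := fun t h1 h2 => by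
    have h3 := hg.mono_right h1
    have h4 := (hg.step t).2.1
    have h5 := hX0 t h1 h2
    omega
  have h1 := hg.succ_le (t₀ + 1)
  have h2 := hg.mono_left (show t₀ ≤ t₀ + 2 by omega)
  have h3 := (F.single_l h).le_succ t₀
  have h4 := hl t₀
  have h5 := hSe1 t₀ le_rfl (by omega)
  have h6 := (hg.step t₀).1
  rw [show t₀ + 1 + 1 = t₀ + 2 by omega, h4] at h1
  obtain ⟨e, he⟩ : ∃ e, e = Sg cr h (t₀ + 2) + cr (h, .Zg) 0 (t₀ + 2) := ⟨_, rfl⟩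
  -- At `t₀ + s + D + 1` all old packets and all `Zg` have reached `g`, but no `X` has. The few
  -- packets in transit at the start only shift the release time `τ` by a bounded amount.
  obtain ⟨h7, h8⟩ := hg.block (T := t₀ + 2) (M := t₀ + s + D + 1) (t₁ := t₁)
    (α := α + (z₀ + z)) (β := β) (n := n) (by omega)
    (fun t h7 h8 => by
      obtain ⟨u, rfl⟩ : ∃ u, t = u + 1 := ⟨t - 1, by omega⟩
      rw [hl, hSe2 u (by omega) (by omega), hZ2 _ (by omega) h8])
    (hXc _ (by omega) (by omega)) (fun t h7 h8 => hX0 t (by omega) h8)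
    (fun t h7 h8 => hX1 t (by omega) h8)
    (fun t h7 h8 => by
      obtain ⟨u, rfl⟩ : ∃ u, t = u + 1 := ⟨t - 1, by omega⟩
      rw [hl, ← he]
      have h9 := hZm (show t₀ + 1 ≤ u + 1 by omega)
      rcases le_total u (t₀ + R) with h10 | h10
      · have := hSe1 u (by omega) h10
        omega
      · have := hSe2 u h10 (by omega)
        have := hZ2 (u + 1) (by omega) (by omega)
        omega)
    (by omega) (by omega)
  rw [← he] at h7 h8 h1 h2
  obtain ⟨τ, hτ⟩ : ∃ τ, τ + e = t₀ + 2 + (α + (z₀ + z)) :=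
    ⟨t₀ + 2 + (α + (z₀ + z)) - e, by omega⟩
  refine ⟨τ, by omega, by omega, fun t h9 h10 => ?_, fun t h9 h10 => ?_⟩
  · rcases le_total t (t₀ + s + D + 1) with h11 | h11
    · exact hXc t h9 h11
    · exact (h7 t (by omega) (by omega)).2
  · have := h8 t (by omega) h10
    rw [show t + e - (t₀ + 2 + (α + (z₀ + z))) = t - τ by omega] at this
    exact this

/-- The packets `W` and `Zy` delay the packets `Y`. -/
theorem fifo_Y_at_y {h : Bool} {t₀ t₁ s D R z₀ z w n α β : ℕ} (hw : 0 < w) (hsR : s ≤ R)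
    (hRD : R ≤ s + D) (hDz : D + 10 ≤ z) (ht₁ : t₀ + R + 3 + w + z ≤ t₁)
    (hW1 : ∀ t, t₀ ≤ t → t ≤ t₀ + R → cr (h, .W) 0 t = α)
    (hW2 : ∀ t, t₀ + R ≤ t → t ≤ t₁ → cr (h, .W) 0 t = α + min w (t - (t₀ + R)))
    (hW : cr (h, .W) 3 t₀ = α)
    (hZ : cr (h, .Zy) 0 t₀ = z₀)
    (hZ1 : ∀ t, t₀ ≤ t → t ≤ t₀ + s + D + 3 → ar (h, .Zy) 0 t = z₀)
    (hZ2 : ∀ t, t₀ + s + w ≤ t → t ≤ t₁ → ar (h, .Zy) 0 t = z₀ + z)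
    (hY : cr (h, .Y) 0 t₀ = β)
    (hY0 : ∀ t, t₀ ≤ t → t ≤ t₀ + s + D + 2 + w → ar (h, .Y) 0 t = β)
    (hY1 : ∀ t, t₀ + s + w + z + 3 ≤ t → t ≤ t₁ → ar (h, .Y) 0 t = β + n) :
    (∀ t, t₀ ≤ t → t ≤ t₀ + R + 3 + w + z → cr (h, .Y) 0 t = β) ∧
    (∀ t, t₀ + R + 3 + w + z ≤ t → t ≤ t₁ →
      cr (h, .W) 3 t + cr (h, .Zy) 0 t = α + w + (z₀ + z) ∧
        cr (h, .Y) 0 t = β + min n (t - (t₀ + R + 3 + w + z))) := by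
  have hy := F.fifo_y rfl h
  have hj := F.fifo_W_succ h
  have hZm := F.ar_mono (h, .Zy)
  have hYc : ∀ t, t₀ ≤ t → t ≤ t₀ + s + D + 2 + w → cr (h, .Y) 0 t = β := fun t h1 h2 => by
    have h3 := hy.mono_right h1
    have h4 := (hy.step t).2.1
    have h5 := hY0 t h1 h2
    omega
  have h0 : cr (h, .W) 3 (t₀ + R + 3) + cr (h, .Zy) 0 (t₀ + R + 3) = α + z₀ := by
    have h1 := (hy.succ_le (t₀ + R + 2)).1
    have h2 := hy.mono_left (show t₀ ≤ t₀ + R + 3 by omega)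
    rw [hj, hW1 _ (by omega) le_rfl, hZ1 _ (by omega) (by omega)] at h1
    simp only [Nat.add_assoc, Nat.reduceAdd] at h1 h2 ⊢
    omega
  -- The first `W` reaches `y` at `t₀ + R + 3`. From then on either a `W` arrives in each step or
  -- the `Zy` that have accumulated keep `y` busy.
  obtain ⟨h7, h8⟩ := hy.block (T := t₀ + R + 3) (M := t₀ + s + D + 2 + w) (t₁ := t₁)
    (α := α + w + (z₀ + z)) (β := β) (n := n) (by omega)
    (fun t h7 h8 => by
      obtain ⟨u, rfl⟩ : ∃ u, t = u + 2 := ⟨t - 2, by omega⟩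
      rw [hj, hW2 u (by omega) (by omega), hZ2 _ (by omega) h8]
      omega)
    (hYc _ (by omega) (by omega)) (fun t h7 h8 => hY0 t (by omega) h8)
    (fun t h7 h8 => hY1 t (by omega) h8)
    (fun t h7 h8 => by
      obtain ⟨u, rfl⟩ : ∃ u, t = u + 2 := ⟨t - 2, by omega⟩
      rw [hj, h0, hW2 u (by omega) (by omega)]
      have h9 := hZm (show t₀ ≤ u + 2 by omega)
      have h10 := hZ1 t₀ le_rfl (by omega)
      rcases le_total (u + 2) (t₀ + s + w) with h11 | h11
      · omega
      · have := hZ2 (u + 2) h11 (by omega)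
        omega)
    (by omega) (by omega)
  rw [h0] at h7 h8
  refine ⟨fun t h9 h10 => ?_, fun t h9 h10 => ?_⟩
  · rcases le_total t (t₀ + R + 3) with h11 | h11
    · exact hYc t h9 (by omega)
    · exact (h7 t (by omega) (by omega)).2
  · have := h8 t (by omega) h10
    rw [show t + (α + z₀) - (t₀ + R + 3 + (α + w + (z₀ + z))) =
      t - (t₀ + R + 3 + w + z) by omega] at this
    exact this

end Fifo

/-! ### Numbers for the rate 17 / 19 -/

/-- The numbers of packets that reach a link `e` from the links `x` and `m` and from outside, at
the end of a phase against first-in-first-out. -/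
theorem fifo_rates {X Y V : ℕ → ℕ} {n c τ τ' m t₁ v j : ℕ} (hn : 0 < n)
    (hX : Monotone X) (hY : Monotone Y) (hV : Monotone V)
    (hm1 : m + 1021 ≤ τ + 63849348 * n) (hm2 : τ + 63849348 * n ≤ m + 2024)
    (hv : τ + 40000000 * n ≤ v)
    (hτ' : m ≤ τ') (hτ'm : τ' ≤ m + 1003) (ht₁ : t₁ = m + 57128364 * n + 2030)
    (hX1 : ∀ t y, τ ≤ t → t ≤ t₁ → τ + y + 1 ≤ v → y ≤ 63849348 * n - 1020 →
      19 * (t - τ) + 17 * 19 ≤ 19 * y + 17 * y → X t ≤ c + y)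
    (hX2 : ∀ t y, τ + 1 ≤ t → t ≤ t₁ → 19 * y + 17 * y + 17 * 19 ≤ 19 * (t - τ - 1) →
      c + min (63849348 * n - 1020) y ≤ X t)
    (hY1 : ∀ t, τ' + 1 ≤ t → t ≤ t₁ →
      Y t = Y m + min (57128364 * n - 2040) (t - 1 - τ'))
    (hj : 10000 ≤ j)
    (hV1 : ∀ t, m ≤ t → t ≤ t₁ →
      V t = V m + slots 17 19 (m + 1) (min (t + 1) (m + 1 + 19 * j))) :
    X m + 529 ≤ c + 33698267 * n ∧ c + 33698267 * n ≤ X m + 1078 ∧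
    ∀ t, m ≤ t → t < t₁ →
      X m + Y m + V m + (t - m) + 1 ≤ X t + Y t + V t + 100 := by
  -- `33698267 * n` is `19 / 36` of `63849348 * n`, since `X` leaves `x` at rate 1/(1 + ρ) = 19/36.
  -- The offsets 529 and 1078 are the sharpest integers allowed by the bounds on `m - τ` and the
  -- rounding error `17 * 19`.
  have h1 := hX1 m (33698267 * n - 529) (by omega) (by omega) (by omega) (by omega) (by omega)
  have h2 := hX2 m (33698267 * n - 1078) (by omega) (by omega) (by omega)
  refine ⟨by omega, by omega, ?_⟩
  have hVlo : ∀ L, L ≤ 10000 → m + L ≤ t₁ → 17 * L ≤ 19 * (V (m + L) - V m) + 17 * 19 := by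
    intro L h3 h4
    have h5 := (slots_bounds (p := 17) (q := 19) (by omega) (by omega) (m + 1) L).2
    rw [hV1 (m + L) (by omega) h4, min_eq_left (by omega),
      show m + L + 1 = m + 1 + L by omega]
    omega
  have key : ∀ L, L ≤ 1004 → X m + V m + L + 1 ≤ X (m + L) + V (m + L) + 100 := by
    intro L hL
    have h3 := hVlo L (by omega) (by omega)
    -- The two witnesses are `19 / 36` of the elapsed time, rounded up and down. Until `Y` starts,
    -- `X` and `V` together supply 19/36 + 17/19 > 1 packets per step, up to a bounded error.
    have h4 := hX1 m ((19 * (m - τ) + 323 + 35) / 36) (by omega) (by omega) (by omega) (by omega)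
      (by omega)
    have h5 := hX2 (m + L) ((19 * (m + L - τ - 1) - 323) / 36) (by omega) (by omega) (by omega)
    have h6 := hV (show m ≤ m + L by omega)
    omega
  intro t h3 h4
  rcases le_total t (τ' + 1) with h5 | h5
  · have h6 := key (t - m) (by omega)
    rw [show m + (t - m) = t by omega] at h6
    have h7 := hY h3
    omega
  · have h6 := key (τ' + 1 - m) (by omega)
    rw [show m + (τ' + 1 - m) = τ' + 1 by omega] at h6
    have h7 := hY1 t h5 h4.le
    have h8 := hX h5
    have h9 := hV h5
    rcases le_total (t - 1 - τ') (57128364 * n - 2040) with h10 | h10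
    · omega
    · have h11 := hVlo 10000 le_rfl (by omega)
      have h12 := hV (show m + 10000 ≤ t by omega)
      have h13 := hX h3
      omega

/-- The times, relative to the start of the phase, from which on the packets of a load are injected
in a phase against first-in-first-out. -/
def fifoLo (n : ℕ) : Load → ℕ
  | .W => 1 | .Zg => 1 | .X => 79756452 * n + 1002 | .Zx => 151117488 * n
  | .Zy => 79756452 * n + 1004 | .Y => 151117488 * n + 1003 | .V => 214966836 * n - 1019

/-- A phase against first-in-first-out injects `17 * fifoNum n L` packets of load `L`. -/
def fifoNum (n : ℕ) : Load → ℕ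
  | .W => 4197708 * n | .Zg => 4197708 * n | .X => 3755844 * n - 60 | .Zx => 3360492 * n - 60
  | .Zy => 3755844 * n - 60 | .Y => 3360492 * n - 120 | .V => 2917963 * n + 4691825

/-- The unit `79756452 = 36 * 17 * 19 ^ 4` makes s, ρs, ρ²s, ρ³s and ρ²s/(1 + ρ) integer multiples
of `n` at ρ = 17/19. A window starts roughly at a partial sum of s, ρs, ρ²s, ρ³s, shifted to allow
for the uncertainty 1000 of the backlog; the subtracted constants keep windows disjoint. The values
are recorded as equations for `omega`. -/
theorem fifoLo_apply (n : ℕ) :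
    fifoLo n .W = 1 ∧
    fifoLo n .Zg = 1 ∧
    fifoLo n .X = 79756452 * n + 1002 ∧
    fifoLo n .Zx = 151117488 * n ∧
    fifoLo n .Zy = 79756452 * n + 1004 ∧
    fifoLo n .Y = 151117488 * n + 1003 ∧
    fifoLo n .V = 214966836 * n - 1019 :=
  ⟨rfl, rfl, rfl, rfl, rfl, rfl, rfl⟩

theorem fifoNum_apply (n : ℕ) :
    fifoNum n .W = 4197708 * n ∧
    fifoNum n .Zg = 4197708 * n ∧
    fifoNum n .X = 3755844 * n - 60 ∧
    fifoNum n .Zx = 3360492 * n - 60 ∧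
    fifoNum n .Zy = 3755844 * n - 60 ∧
    fifoNum n .Y = 3360492 * n - 120 ∧
    fifoNum n .V = 2917963 * n + 4691825 :=
  ⟨rfl, rfl, rfl, rfl, rfl, rfl, rfl⟩

/-- The state under first-in-first-out at time `t`, when the half `h` is about to be filled: between
`79756452 * n` and `79756452 * n + 1000` packets await its link `e`, and hardly anything else is
left. -/
structure FifoInv (ar cr : Kind → ℕ → ℕ → ℕ) (h : Bool) (t n : ℕ) : Prop where
  Sg : Sg cr (!h) t = Stot ar (!h) t
  W : ∀ b, cr (b, .W) 3 t = ar (b, .W) 0 t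
  Zx : ∀ b, cr (b, .Zx) 0 t = ar (b, .Zx) 0 t
  Zg : ∀ b, cr (b, .Zg) 0 t = ar (b, .Zg) 0 t
  Zy : ∀ b, cr (b, .Zy) 0 t = ar (b, .Zy) 0 t
  Sa : Sa ar cr h t = Stot ar h t
  Sl : Sl cr h t ≤ _root_.Sg cr h t + 1
  lower : Se cr h t + 79756452 * n ≤ Stot ar h t
  upper : Stot ar h t ≤ Se cr h t + 79756452 * n + 1000

/-! ### A phase against first-in-first-out -/

section Phase

variable {num : ℕ → Kind → ℕ} {ar cr : Kind → ℕ → ℕ → ℕ}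

theorem IsFlow.Sl_le_Se {π : Network.Protocol} (F : IsFlow num π ar cr) (h : Bool) (t : ℕ) :
    Sl cr h t ≤ Se cr h t := by
  have := F.single_l h t
  omega

theorem IsFlow.Sg_le_Sl {π : Network.Protocol} (F : IsFlow num π ar cr) (h : Bool) (t : ℕ) :
    Sg cr h t ≤ Sl cr h t := by
  have h1 := F.chain (!h, .X) 3 t (by simp [route])
  have h2 := F.chain (!h, .Y) 3 t (by simp [route])
  have h3 := F.chain (!h, .V) 1 t (by simp [route])
  simp only [Nat.reduceAdd] at h1 h2 h3
  simp only [Sg, Sl]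
  omega

theorem IsFlow.Se_le_Sa {π : Network.Protocol} (F : IsFlow num π ar cr) (h : Bool) (t : ℕ) :
    Se cr h t ≤ Sa ar cr h t := by
  have h1 := F.chain (!h, .X) 1 t (by simp [route])
  have h2 := F.chain (!h, .Y) 1 t (by simp [route])
  have h3 := F.cr_le (!h, .V) 0 t (by simp [route])
  simp only [Se, Sa]
  simp only [Nat.reduceAdd] at h1 h2
  omega

theorem IsFlow.Se_eq_of_Sg_eq {π : Network.Protocol} (F : IsFlow num π ar cr) {h : Bool} {t : ℕ}
    (hS : Sg cr h t = Stot ar h t) : Se cr h t = Stot ar h t ∧ Sl cr h t = Stot ar h t := by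
  have h1 := F.Sg_le_Sl h t
  have h2 := F.Sl_le_Se h t
  have h3 := F.Se_le_Sa h t
  have h4 := F.Sa_le_Stot h t
  omega

variable (F : IsFlow num .fifo ar cr) {h : Bool} {t₀ n : ℕ} (hn : 100 ≤ n)
  (hS : ∀ t, t₀ ≤ t → t ≤ t₀ + 272095200 * n + 1010 → Stot ar h t = Stot ar h t₀)
  (P : ∀ L, Pulse (ar (h, L) 0) 17 19 t₀ (t₀ + 272095200 * n + 1010) (t₀ + fifoLo n L)
    (t₀ + fifoLo n L + 19 * fifoNum n L))
  (I : FifoInv ar cr h t₀ n)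
include F hn hS P I

/-- The half `h` during the phase. -/
theorem fifo_blocked : ∃ R τ, 79756452 * n ≤ R ∧ R ≤ 79756452 * n + 1000 ∧
    t₀ + R + 71361036 * n + 1 ≤ τ ∧ τ ≤ t₀ + R + 71361036 * n + 4 ∧
    (∀ t, t₀ ≤ t → t ≤ τ → cr (h, .X) 0 t = ar (h, .X) 0 t₀) ∧
    (∀ t, τ ≤ t → t ≤ t₀ + 272095200 * n + 1010 →
      cr (h, .X) 0 t = ar (h, .X) 0 t₀ + min (63849348 * n - 1020) (t - τ)) ∧
    (∀ t, t₀ ≤ t → t ≤ t₀ + R + 135210384 * n - 1017 →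
      cr (h, .Y) 0 t = ar (h, .Y) 0 t₀) ∧
    (∀ t, t₀ + R + 135210384 * n - 1017 ≤ t → t ≤ t₀ + 272095200 * n + 1010 →
      cr (h, .Y) 0 t = ar (h, .Y) 0 t₀ +
        min (57128364 * n - 2040) (t - (t₀ + R + 135210384 * n - 1017))) ∧
    Sg cr h (t₀ + 272095200 * n + 1010) = Stot ar h (t₀ + 272095200 * n + 1010) ∧
    cr (h, .W) 3 (t₀ + 272095200 * n + 1010) = ar (h, .W) 0 (t₀ + 272095200 * n + 1010) ∧
    cr (h, .Zg) 0 (t₀ + 272095200 * n + 1010) = ar (h, .Zg) 0 (t₀ + 272095200 * n + 1010) ∧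
    cr (h, .Zy) 0 (t₀ + 272095200 * n + 1010) = ar (h, .Zy) 0 (t₀ + 272095200 * n + 1010) := by
  have hI0 : ∀ L t, t₀ ≤ t → t < t₀ + fifoLo n L → t ≤ t₀ + 272095200 * n + 1010 →
    ar (h, L) 0 t = ar (h, L) 0 t₀ := fun L t h1 h2 h3 => (P L).before h1 h3 h2
  have hI1 : ∀ L t, t₀ ≤ t → t₀ + fifoLo n L + 19 * fifoNum n L ≤ t + 1 →
      t ≤ t₀ + 272095200 * n + 1010 → ar (h, L) 0 t = ar (h, L) 0 t₀ + 17 * fifoNum n L :=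
    fun L t h1 h2 h3 => (P L).after (by omega) h1 h3 h2
  have hlo := fifoLo_apply n
  have hnum := fifoNum_apply n
  have hlow := I.lower
  have hup := I.upper
  have hgl := I.Sl
  have hX0 := F.X_all_crossed (F.Se_eq_of_Sg_eq I.Sg).1
  have hW0 := F.W_all_crossed (I.W h)
  obtain ⟨R, hR⟩ : ∃ R, Se cr h t₀ + R = Stot ar h t₀ := ⟨_, Nat.add_sub_cancel' (by omega)⟩
  -- All packets of the old backlog were at `e` or beyond at `t₀`, and this phase injects none for
  -- it, so they precede every `W`.
  have hSa : ∀ t, t₀ ≤ t → t ≤ t₀ + 272095200 * n + 1010 → Sa ar cr h t = Stot ar h t₀ := by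
    intro t h1 h2
    have h3 := F.Sa_le_Stot h t
    rw [hS t h1 h2] at h3
    have h4 := I.Sa
    have h5 := F.cr_mono (!h, .X) 1 (by simp [route]) h1
    have h6 := F.cr_mono (!h, .Y) 1 (by simp [route]) h1
    have h7 := F.ar_mono (!h, .V) h1
    simp only [Sa] at h3 h4 ⊢
    omega
  obtain ⟨e1, e2⟩ := fifo_W_at_e F (w := 71361036 * n) hR hSa hW0.1 rfl (fun t h1 h2 => by
    rw [hI1 .W t (by omega) (by omega) h2]; omega) (by omega)
  obtain ⟨τ, g0, g1, g2, g3⟩ := fifo_X_at_g F (s := 79756452 * n) (D := 1000) (z := 71361036 * n)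
    (n := 63849348 * n - 1020) (by omega) (by omega) (by omega) (by omega)
    (show t₀ + R + 71361036 * n + 4 ≤ t₀ + 272095200 * n + 1010 by omega)
    (fun t h1 h2 => (e1 t h1 h2).1) (fun t h1 h2 => (e2 t h1 h2).1) hgl (I.Zg h) rfl
    ((P .Zg).step_le le_rfl (by omega))
    (fun t h1 h2 => by
      rw [hI1 .Zg t (by omega) (by omega) h2]; omega)
    hX0.1 (fun t h1 h2 => hI0 .X t h1 (by omega) (by omega))
    (fun t h1 h2 => by
      rw [hI1 .X t (by omega) (by omega) h2]; omega)
  obtain ⟨y1, y2⟩ := fifo_Y_at_y F (s := 79756452 * n) (D := 1000) (w := 71361036 * n)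
    (z := 63849348 * n - 1020) (n := 57128364 * n - 2040) (by omega) (by omega) (by omega)
    (by omega)
    (show t₀ + R + 3 + 71361036 * n + (63849348 * n - 1020) ≤ t₀ + 272095200 * n + 1010 by omega)
    (fun t h1 h2 => (e1 t h1 h2).2) (fun t h1 h2 => (e2 t h1 h2).2) (I.W h) (I.Zy h)
    (fun t h1 h2 => hI0 .Zy t h1 (by omega) (by omega))
    (fun t h1 h2 => by
      rw [hI1 .Zy t (by omega) (by omega) h2]; omega)
    hX0.2.2.1 (fun t h1 h2 => hI0 .Y t h1 (by omega) (by omega))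
    (fun t h1 h2 => by
      rw [hI1 .Y t (by omega) (by omega) h2]; omega)
  rw [show t₀ + R + 3 + 71361036 * n + (63849348 * n - 1020) = t₀ + R + 135210384 * n - 1017
    by omega] at y1 y2
  refine ⟨R, τ, by omega, by omega, g0, g1, g2, fun t h1 h2 => (g3 t h1 h2).2, y1,
    fun t h1 h2 => (y2 t h1 h2).2, ?_⟩
  obtain ⟨t₁, ht₁⟩ : ∃ t₁, t₁ = t₀ + 272095200 * n + 1010 := ⟨_, rfl⟩
  have h1 := (g3 t₁ (by omega) (by omega)).1
  have h2 := (y2 t₁ (by omega) (by omega)).1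
  have h3 := hI1 .Zg t₁ (by omega) (by omega) (by omega)
  have h4 := hI1 .Zy t₁ (by omega) (by omega) (by omega)
  have h5 := hI1 .W t₁ (by omega) (by omega) (by omega)
  have h6 := hS t₁ (by omega) (by omega)
  have h7 := (e2 t₁ (by omega) (by omega)).1
  rw [← ht₁]
  clear e1 e2 g2 g3 y1 y2 hI0 hI1 hS P hSa hX0 hW0
  have h8 := F.Sl_le_Se h t₁
  have h9 := F.Sg_le_Sl h t₁
  have h10 := F.cr_le (h, .Zg) 0 t₁ (by simp [route])
  have h11 := F.cr_le (h, .Zy) 0 t₁ (by simp [route])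
  have h12 := F.chain (h, .W) 0 t₁ (by simp [route])
  have h13 := F.chain (h, .W) 1 t₁ (by simp [route])
  have h14 := F.chain (h, .W) 2 t₁ (by simp [route])
  have h15 := F.cr_le (h, .W) 0 t₁ (by simp [route])
  simp only [zero_add, Nat.reduceAdd] at h12 h13 h14
  omega

end Phase

section Phase

variable {num : ℕ → Kind → ℕ} {ar cr : Kind → ℕ → ℕ → ℕ}

/-- The packets `Zx` slow the packets `X` down. -/
theorem fifo_X_at_x (F : IsFlow num .fifo ar cr) {h : Bool} {t₀ n : ℕ} (hn : 100 ≤ n)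
    (P : Pulse (ar (h, .Zx) 0) 17 19 t₀ (t₀ + 272095200 * n + 1010) (t₀ + fifoLo n .Zx)
      (t₀ + fifoLo n .Zx + 19 * fifoNum n .Zx))
    (hZ : cr (h, .Zx) 0 t₀ = ar (h, .Zx) 0 t₀) (hX : cr (h, .X) 1 t₀ = ar (h, .X) 0 t₀) {τ : ℕ}
    (hτ1 : t₀ + 151117488 * n + 1 ≤ τ) (hτ2 : τ ≤ t₀ + 151117488 * n + 1004)
    (hg1 : ∀ t, t₀ ≤ t → t ≤ τ → cr (h, .X) 0 t = ar (h, .X) 0 t₀)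
    (hg2 : ∀ t, τ ≤ t → t ≤ t₀ + 272095200 * n + 1010 →
      cr (h, .X) 0 t = ar (h, .X) 0 t₀ + min (63849348 * n - 1020) (t - τ)) :
    (cr (h, .Zx) 0 (t₀ + 272095200 * n + 1010) = ar (h, .Zx) 0 (t₀ + 272095200 * n + 1010) ∧
      cr (h, .X) 1 (t₀ + 272095200 * n + 1010) =
        ar (h, .X) 0 t₀ + (63849348 * n - 1020)) ∧
    (∀ t y, τ ≤ t → t ≤ t₀ + 272095200 * n + 1010 →
      τ + y + 1 ≤ t₀ + fifoLo n .Zx + 19 * fifoNum n .Zx → y ≤ 63849348 * n - 1020 →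
      19 * (t - τ) + 17 * 19 ≤ 19 * y + 17 * y → cr (h, .X) 1 t ≤ ar (h, .X) 0 t₀ + y) ∧
    (∀ t y, τ + 1 ≤ t → t ≤ t₀ + 272095200 * n + 1010 →
      19 * y + 17 * y + 17 * 19 ≤ 19 * (t - τ - 1) →
      ar (h, .X) 0 t₀ + min (63849348 * n - 1020) y ≤ cr (h, .X) 1 t) := by
  have hlo := fifoLo_apply n
  have hnum := fifoNum_apply n
  have hs := slots_mul (p := 17) (q := 19) (by omega) (t₀ + fifoLo n .Zx) (fifoNum n .Zx)
  obtain ⟨h1, h2, h3⟩ := (F.fifo_x rfl h).merge (by omega) (by omega) hZ hX P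
    (τ := τ) (n := 63849348 * n - 1020) (by omega) (by omega) (by omega) (by omega)
    (by rw [hs]; omega) hg1 hg2
  exact ⟨h1 _ (by rw [hs]; omega) le_rfl, h2, h3⟩

/-- The half to which the packets head during the phase stays free of other packets. -/
theorem fifo_idle (F : IsFlow num .fifo ar cr) {h : Bool} {t₀ t₁ : ℕ} (h01 : t₀ ≤ t₁)
    (hI : ∀ L t, t₀ ≤ t → t ≤ t₁ → ar (h, L) 0 t = ar (h, L) 0 t₀)
    (hS : Sg cr h t₀ = Stot ar h t₀) (hX : ar (h, .X) 0 t₀ = cr (h, .X) 0 t₀)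
    (hW : cr (h, .W) 3 t₀ = ar (h, .W) 0 t₀) (hZx : cr (h, .Zx) 0 t₀ = ar (h, .Zx) 0 t₀)
    (hZg : cr (h, .Zg) 0 t₀ = ar (h, .Zg) 0 t₀) (hZy : cr (h, .Zy) 0 t₀ = ar (h, .Zy) 0 t₀) :
    cr (h, .W) 3 t₁ = ar (h, .W) 0 t₁ ∧ cr (h, .Zx) 0 t₁ = ar (h, .Zx) 0 t₁ ∧
    cr (h, .Zg) 0 t₁ = ar (h, .Zg) 0 t₁ ∧ cr (h, .Zy) 0 t₁ = ar (h, .Zy) 0 t₁ ∧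
    Sl cr h t₁ ≤ Sg cr h t₁ + 1 := by
  have hZ : ∀ L, 0 < (route (h, L)).length → cr (h, L) 0 t₀ = ar (h, L) 0 t₀ →
      ∀ t, t₀ ≤ t → t ≤ t₁ → cr (h, L) 0 t = ar (h, L) 0 t := fun L hL h1 t h2 h3 => by
    have h4 := F.cr_mono (h, L) 0 hL h2
    have h5 := F.cr_le (h, L) 0 t hL
    have h6 := hI L t h2 h3
    omega
  refine ⟨?_, hZ .Zx (by simp [route]) hZx _ h01 le_rfl, hZ .Zg (by simp [route]) hZg _ h01 le_rfl,
    hZ .Zy (by simp [route]) hZy _ h01 le_rfl, ?_⟩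
  · have h1 := F.cr_mono (h, .W) 3 (by simp [route]) h01
    have h2 := F.chain (h, .W) 0 t₁ (by simp [route])
    have h3 := F.chain (h, .W) 1 t₁ (by simp [route])
    have h4 := F.chain (h, .W) 2 t₁ (by simp [route])
    have h5 := F.cr_le (h, .W) 0 t₁ (by simp [route])
    have h6 := hI .W t₁ h01 le_rfl
    simp only [zero_add, Nat.reduceAdd] at h2 h3 h4
    omega
  · have h1 := (F.fifo_g rfl h).trickle hX.symm (hI .X) (t₁ := t₁)
      (by
        have := F.Se_eq_of_Sg_eq hS
        omega)
      (fun t h1 h2 => by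
        have h3 := (F.single_l h).le_succ t
        have h4 := hI .Zg t h1 (by omega)
        have h5 := hI .Zg (t + 1) (by omega) (by omega)
        omega) h01 le_rfl
    have h2 := hZ .Zg (by simp [route]) hZg _ h01 le_rfl
    omega

/-- The packets that reach the link `e` of the next half in the second part of the phase keep it
busy. -/
theorem fifo_next (F : IsFlow num .fifo ar cr) {h : Bool} {t₀ m t₁ β : ℕ} (h0m : t₀ ≤ m)
    (hm1 : m ≤ t₁) (hW : cr (h, .W) 0 t₀ = β) (hI : ∀ t, t₀ ≤ t → t ≤ t₁ → ar (h, .W) 0 t = β)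
    (h0 : Sa ar cr h t₀ ≤ Se cr h t₀)
    (h1 : ∀ t, t₀ ≤ t → t < m → Sa ar cr h (t + 1) ≤ Sa ar cr h t + 1)
    (h2 : ∀ t, m ≤ t → t < t₁ → Sa ar cr h m + (t - m) + 1 ≤ Sa ar cr h t + 100)
    (h3 : 100 ≤ Sa ar cr h m) :
    Se cr h t₁ ≤ Sa ar cr h m + (t₁ - m) ∧ Sa ar cr h m + (t₁ - m) ≤ Se cr h t₁ + 100 := by
  have he := F.fifo_e rfl h
  have h4 : Sa ar cr h m ≤ Se cr h m + 1 :=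
    he.trickle hW (fun t h4 h5 => hI t h4 (h5.trans hm1)) (by omega) h1 h0m le_rfl
  have h5 : cr (h, .W) 0 m = β := by
    have h5 := he.mono_right h0m
    have h6 := (he.step m).2.1
    have h7 := hI m h0m hm1
    omega
  refine ⟨?_, ?_⟩
  · clear h2
    induction t₁, hm1 using Nat.le_induction with
    | base => have := (he.step m).1; omega
    | succ t ht ih =>
      have h6 := ih fun t h4 h5 => hI t h4 (by omega)
      have h7 := (he.le_succ t).1
      omega
  -- The arrivals may lag 100 behind one per step, so the service is compared with a line that
  -- starts 100 lower.
  · obtain ⟨K, hK⟩ : ∃ K, K + 100 = Sa ar cr h m := ⟨_, Nat.sub_add_cancel h3⟩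
    have h6 := he.keep_busy (K := K) h5 (fun t h6 h7 => hI t (by omega) h7) (by omega)
      (fun t h6 h7 => by have := h2 t h6 h7; omega) hm1 le_rfl
    omega

/-- Until about s + ρs + ρ²s only the leakage of `X` reaches the other half, at most one packet per
step, so it crosses `e` there without queueing. In the last period `X`, `Y` and `V` come faster than
they can be served, and what remains is the new backlog. -/
theorem fifo_phase (F : IsFlow num .fifo ar cr) {h : Bool} {t₀ n : ℕ} (hn : 100 ≤ n)
    (hI : ∀ L t, t₀ ≤ t → t ≤ t₀ + 272095200 * n + 1010 →
      ar (!h, L) 0 t = ar (!h, L) 0 t₀)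
    (P : ∀ L, Pulse (ar (h, L) 0) 17 19 t₀ (t₀ + 272095200 * n + 1010) (t₀ + fifoLo n L)
      (t₀ + fifoLo n L + 19 * fifoNum n L))
    (I : FifoInv ar cr h t₀ n) :
    FifoInv ar cr (!h) (t₀ + 272095200 * n + 1010) (n + 1) := by
  have hS : ∀ t, t₀ ≤ t → t ≤ t₀ + 272095200 * n + 1010 → Stot ar h t = Stot ar h t₀ :=
    fun t h1 h2 => by simp only [Stot, hI _ t h1 h2]
  obtain ⟨R, τ, hR1, hR2, hτ1, hτ2, hg1, hg2, hy1, hy2, eSg, eW, eZg, eZy⟩ :=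
    fifo_blocked F hn hS P I
  have hX0 := F.X_all_crossed (F.Se_eq_of_Sg_eq I.Sg).1
  obtain ⟨⟨eZx, eX⟩, hx1, hx2⟩ := fifo_X_at_x F hn (P .Zx) (I.Zx h) hX0.2.1 (τ := τ) (by omega)
    (by omega) hg1 hg2
  obtain ⟨iW, iZx, iZg, iZy, iSl⟩ := fifo_idle F (h := !h)
    (show t₀ ≤ t₀ + 272095200 * n + 1010 by omega) hI I.Sg
    (by
      have h1 := F.cr_le (!h, .X) 0 t₀ (by simp [route])
      have h2 := F.chain (!h, .X) 0 t₀ (by simp [route])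
      have h3 := F.chain (!h, .Y) 0 t₀ (by simp [route])
      have h4 := F.cr_le (!h, .Y) 0 t₀ (by simp [route])
      have h5 := I.Sa
      simp only [Sa, Stot] at h5
      simp only [zero_add] at h2 h3
      omega)
    (I.W _) (I.Zx _) (I.Zg _) (I.Zy _)
  have hlo := fifoLo_apply n
  have hnum := fifoNum_apply n
  -- Just before the window of `V` opens, and no later than the release of `Y`.
  obtain ⟨m, hm⟩ : ∃ m, m + 1020 = t₀ + 214966836 * n :=
    ⟨_, Nat.sub_add_cancel (by omega)⟩
  have hV1 : ∀ t, t₀ ≤ t → t ≤ m → ar (h, .V) 0 t = ar (h, .V) 0 t₀ :=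
    fun t h1 h2 => (P .V).before h1 (by omega) (by omega)
  have hV2 : ∀ t, m ≤ t → t ≤ t₀ + 272095200 * n + 1010 → ar (h, .V) 0 t =
      ar (h, .V) 0 m + slots 17 19 (m + 1) (min (t + 1) (m + 1 + 19 * fifoNum n .V)) := by
    intro t h1 h2
    rw [P .V t (by omega) h2, hV1 m (by omega) le_rfl, show t₀ + fifoLo n .V = m + 1 by omega]
  have hm_succ := F.fifo_m_succ h
  have hY1 : ∀ t, t₀ ≤ t → t ≤ m → cr (h, .Y) 1 t = ar (h, .Y) 0 t₀ := by
    intro t h1 h2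
    rcases (by omega : t = t₀ ∨ t₀ < t) with rfl | h3
    · exact hX0.2.2.2.1
    · obtain ⟨u, rfl⟩ : ∃ u, t = u + 1 := ⟨t - 1, by omega⟩
      rw [hm_succ, hy1 u (by omega) (by omega)]
  have hY2 : ∀ t, t₀ + R + 135210384 * n - 1017 + 1 ≤ t → t ≤ t₀ + 272095200 * n + 1010 →
      cr (h, .Y) 1 t = cr (h, .Y) 1 m +
        min (57128364 * n - 2040) (t - 1 - (t₀ + R + 135210384 * n - 1017)) := by
    intro t h1 h2
    obtain ⟨u, rfl⟩ : ∃ u, t = u + 1 := ⟨t - 1, by omega⟩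
    rw [hm_succ, hY1 m (by omega) le_rfl, hy2 u (by omega) (by omega), Nat.add_sub_cancel]
  obtain ⟨a1, a2, a3⟩ := fifo_rates (X := cr (h, .X) 1) (Y := cr (h, .Y) 1) (V := ar (h, .V) 0)
    (n := n) (m := m) (t₁ := t₀ + 272095200 * n + 1010) (by omega)
    (F.cr_mono _ _ (by simp [route])) (F.cr_mono _ _ (by simp [route])) (F.ar_mono _)
    (by omega) (by omega) (by omega) (by omega) (by omega) (by omega) hx1 hx2 hY2
    (by omega) hV2
  have hSa : ∀ t, Sa ar cr (!h) t =
      cr (h, .X) 1 t + cr (h, .Y) 1 t + ar (h, .V) 0 t := by simp [Sa]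
  have hSt : ∀ t, Stot ar (!h) t =
      ar (h, .X) 0 t + ar (h, .Y) 0 t + ar (h, .V) 0 t := by simp [Stot]
  have hWi := F.W_all_crossed (I.W (!h))
  obtain ⟨b1, b2⟩ := fifo_next F (h := !h) (t₀ := t₀) (m := m)
    (t₁ := t₀ + 272095200 * n + 1010) (by omega) (by omega) hWi.1 (hI .W)
    (by rw [(F.Se_eq_of_Sg_eq I.Sg).1]; exact F.Sa_le_Stot _ _)
    (fun t h1 h2 => by
      rw [hSa, hSa, hY1 t h1 h2.le, hY1 (t + 1) (by omega) h2, hV1 t h1 h2.le,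
        hV1 (t + 1) (by omega) h2]
      have := ((F.fifo_x rfl h).le_succ t).2
      omega)
    (fun t h1 h2 => by
      have := a3 t h1 h2
      rw [hSa, hSa]
      omega)
    (by have := hSa m; omega)
  obtain ⟨t₁, ht₁⟩ : ∃ t₁, t₁ = t₀ + 272095200 * n + 1010 := ⟨_, rfl⟩
  have c1 := (P .X).after (j := fifoNum n .X) (by omega) (t := t₁) (by omega) (by omega) (by omega)
  have c2 := (P .Y).after (j := fifoNum n .Y) (by omega) (t := t₁) (by omega) (by omega) (by omega)
  have c3 := (P .V).after (j := fifoNum n .V) (by omega) (t := t₁) (by omega) (by omega) (by omega)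
  have c4 := hY1 m (by omega) le_rfl
  have c5 := hY2 t₁ (by omega) (by omega)
  have c6 := hV1 m (by omega) le_rfl
  have c7 := hSa m
  have c8 := hSt t₁
  have c9 := hSa t₁
  clear hy1 hy2 hg1 hg2 hx1 hx2 hY1 hY2 hV1 hV2 a3 hSa hSt hm_succ
  rw [← ht₁] at eSg eW eZg eZy eZx eX iW iZx iZg iZy iSl b1 b2 ⊢
  have hb : ∀ {Q : Bool → Prop}, Q h → Q (!h) → ∀ b, Q b := fun h1 h2 b => by
    cases h <;> cases b <;> assumption
  -- The truncated subtractions are removed for `linarith`. The coefficients of `n` balance exactly,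
  -- `63849348 - 33698267 + 17 * 2917963 = 79756452`, and the constant `17 * 4691825` in the number
  -- of `V` supplies the passage from `n` to `n + 1`.
  have d1 : fifoNum n .X + 60 = 3755844 * n := by omega
  have d2 : fifoNum n .Y + 120 = 3360492 * n := by omega
  have d3 : fifoNum n .V = 2917963 * n + 4691825 := by omega
  have d4 : t₁ - m + m = t₁ := by omega
  refine ⟨by rw [Bool.not_not, eSg], hb eW iW, hb eZx iZx, hb eZg iZg, hb eZy iZy, ?_, iSl, ?_, ?_⟩
  · omega
  · linarith
  · linarith

end Phase

/-! ### Conclusion -/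

theorem fifo_isSchedule : IsSchedule (phaseStart fun k => 272095200 * (100 + k) + 1010)
    (fun k => fifoLo (100 + k)) fun k L => fifoLo (100 + k) L + 19 * fifoNum (100 + k) L := by
  refine isSchedule_phaseStart ?_ ?_ ?_
  · intro k L
    have h1 := fifoLo_apply (100 + k)
    cases L <;> omega
  · intro k L
    have h1 := fifoLo_apply (100 + k)
    have h2 := fifoNum_apply (100 + k)
    cases L <;> omega
  · intro k
    have h1 := fifoLo_apply (100 + k)
    have h2 := fifoNum_apply (100 + k)
    simp only [List.forall_mem_cons, List.not_mem_nil, false_implies, implies_true, and_true]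
    omega

theorem IsFlow.fifoInv_start {T : ℕ → ℕ} {lo hi : ℕ → Load → ℕ} {p q n : ℕ}
    {ar cr : Kind → ℕ → ℕ → ℕ} {π : Network.Protocol} (S : IsSchedule T lo hi)
    (F : IsFlow (schedule p q (79756452 * n) T lo hi) π ar cr) : FifoInv ar cr false 0 n := by
  have h := F.ar_zero_start S
  refine ⟨?_, ?_, ?_, ?_, ?_, ?_, ?_, ?_, ?_⟩ <;> simp [Sg, Sl, Sa, Se, Stot, h, F.cr_zero]

theorem fifo_unstable {r : ℝ} (hr : 0.9 ≤ r) :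
    ∃ w : ℕ, 0 < w ∧ ∃ σ : forkNet.Injections,
      σ.Admissible w r ∧ forkNet.UnstableForAllRoutes .fifo σ := by
  have S := fifo_isSchedule
  -- One injection rate, 17/19 < 0.9, serves all `r`. The phases start at `n = 100`, which is large
  -- enough for the window of `V` to fit.
  obtain ⟨W, hW, hadm⟩ := S.admissible (p := 17) (q := 19) (s := 79756452 * 100) (r := r)
    (by omega) (by omega) (lt_of_lt_of_le (by norm_num) hr)
  refine ⟨W, hW, _, hadm, unstable_of_flow fun ar cr F B => ?_⟩
  have key : ∀ k : ℕ, FifoInv ar cr k.bodd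
      (phaseStart (fun k => 272095200 * (100 + k) + 1010) k) (100 + k) := by
    intro k
    induction k with
    | zero => exact F.fifoInv_start S
    | succ k ih =>
      have hT := phaseStart_succ (fun k => 272095200 * (100 + k) + 1010) k
      have hI := fun L t => F.idle_half S k L (t := t)
      have hP := F.pulse S k
      simp only [← add_assoc] at hT hP
      rw [hT] at hI hP ⊢
      have h1 := fifo_phase F (h := k.bodd) (n := 100 + k) (by omega) hI
        hP ih
      rw [Nat.bodd_succ]
      exact h1
  refine ⟨_, _, le_trans ?_ (key B).lower⟩
  omega

theorem theorem3 :
    ∃ G : Network,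
      (∀ r : ℝ, 0.9 ≤ r → r < 1 →
        ∃ w : ℕ, 0 < w ∧ ∃ σ : G.Injections,
          σ.Admissible w r ∧ G.UnstableForAllRoutes .fifo σ) ∧
      (∀ r : ℝ, 1 / Real.sqrt 2 < r → r < 1 →
        ∃ w : ℕ, 0 < w ∧ ∃ σ : G.Injections,
          σ.Admissible w r ∧ G.UnstableForAllRoutes .ntg σ) :=
  ⟨forkNet, fun _ hr _ => fifo_unstable hr, fun _ hr hr1 => ntg_unstable hr hr1⟩
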